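/- Let $\mathfrak t$ be a Euclidean space of dimension $r$ and let $\Phi\subset\mathfrak t$ be a reduced crystallographic root system spanning $\mathfrak t$, with a chosen system $\Phi^+$ of positive roots (for instance the roots of a compact semisimple Lie algebra with Cartan subalgebra $\mathfrak t$, identified with vectors of $\mathfrak t$ by an invariant inner product). Let $Q=\mathbb Z\Phi$ be the root lattice, $d=|\Phi^+|-r$, and let $dx$ be Lebesgue measure on $\mathfrak t$, normalised so that $\mathfrak t/Q$ has volume $1$. The centered box spline is the probability measure $B_c[\Phi^+]$ on $\mathfrak t$ given by $$\int_{\mathfrak t} f\,dB_c[\Phi^+]=\int_{[-1/2,1/2]^{\Phi^+}} f\Big(\sum_{\alpha\in\Phi^+}t_\alpha\alpha\Big)\prod_{\alpha\in\Phi^+}dt_\alpha ,\qquad f\in C^0(\mathfrak t).$$ Let $b$ be its density with respect to $dx$, with the pointwise values $b(x)=\lim_{\varepsilon\to0^+}B_c[\Phi^+](\bar B_\varepsilon(x))/\int_{\bar B_\varepsilon(x)}dx$, where $\bar B_\varepsilon(x)$ is the closed ball of radius $\varepsilon$ about $x$; this is the continuous version of the density wherever one exists locally, in particular near every point of $Q$.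 For $m:Q\to\mathbb C$ put $\mathcal Tm(\gamma)=\sum_{\nu\in Q}m(\nu)\,b(\gamma-\nu)$, and let $$D(\Phi^+)=\{\,p:\mathfrak t\to\mathbb C \text{ a polynomial function}\ :\ p=\mathcal Tm \text{ almost everywhere, for some } m:Q\to\mathbb C\,\}.$$ Write $\partial_\alpha$ for the derivative in the direction $\alpha$, and for $f:\mathfrak t\to\mathbb C$ define $$\mathcal Df(x)=\sum_{\tau\in Q}b(\tau)\,\nabla_\tau\Delta_\tau f(x),\qquad \Delta_\tau f(x)=f(x+\tau)-f(x),\quad \nabla_\tau f(x)=f(x)-f(x-\tau).$$ Let $\hat A(\Phi^+)$ be the infinite-order differential operator $$\hat A(\Phi^+)=\prod_{\alpha\in\Phi^+}\frac{\partial_\alpha}{e^{\frac12\partial_\alpha}-e^{-\frac12\partial_\alpha}}:=\sum_{\vec n\in\mathbb N^{\Phi^+}}\Big(\prod_{\alpha\in\Phi^+}\frac{(2^{1-2n_\alpha}-1)B_{2n_\alpha}}{(2n_\alpha)!}\Big)\prod_{\alpha\in\Phi^+}\partial_\alpha^{2n_\alpha},$$ where $B_{2n}$ is the $2n$-th Bernoulli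 number. Then for every $p\in D(\Phi^+)$ only finitely many terms of the series $\hat A(\Phi^+)p$ are nonzero, and $$\hat A(\Phi^+)\,p=\sum_{k=0}^{\lfloor d/2\rfloor}\Big(-\frac12\mathcal D\Big)^k p .$$ -/

import Mathlib

open MeasureTheory Filter Topology

noncomputable section

namespace BoxSpline

variable {ι V N : Type*} [NormedAddCommGroup V] [InnerProductSpace ℝ V]
  [AddCommGroup N] [Module ℝ N] {P : RootPairing ι ℝ V N}

/-- The index set of the positive roots `Φ⁺` determined by a base `Δ` of the root system: those
roots that are sums of simple roots. -/
abbrev PosRoot (Δ : P.Base) : Type _ :=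
  {i : ι // P.root i ∈ AddSubmonoid.closure (P.root '' Δ.support)}

instance [Finite ι] (Δ : P.Base) : Fintype (PosRoot Δ) := Fintype.ofFinite _

/-- The root lattice `Q ⊂ V`, the `ℤ`-span of the roots. -/
abbrev rootLattice (P : RootPairing ι ℝ V N) : Submodule ℤ V :=
  Submodule.span ℤ (Set.range P.root)

/-- The integer `d = |Φ⁺| - r`, where `r` is the rank.  (Every simple root is a positive root, so
`r ≤ |Φ⁺|` and the subtraction is a true one.) -/
def degD [Finite ι] (Δ : P.Base) : ℕ := Fintype.card (PosRoot Δ) - Module.finrank ℝ V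

/-- Lebesgue measure `dx` on `V`, normalised so that the root lattice has covolume one: the
parallelepiped spanned by the simple roots, a fundamental domain of `Q`, has measure one. -/
def latticeVolume [MeasurableSpace V] [BorelSpace V] [P.IsRootSystem] (Δ : P.Base) : Measure V :=
  Δ.toWeightBasis.addHaar

/-- The centered box spline `B_c[Φ⁺]`: the image of Lebesgue measure on the cube
`[-1/2, 1/2]^{Φ⁺}` under the map `t ↦ ∑ α, t_α α`. -/
def boxSpline [Finite ι] [MeasurableSpace V] (Δ : P.Base) : Measure V :=
  (Measure.pi fun _ : PosRoot Δ => (volume : Measure ℝ).restrict (Set.Icc (-(1 / 2)) (1 / 2))).map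
    fun t => ∑ α : PosRoot Δ, t α • P.root α

/-- The density `b` of the box spline with respect to `dx`, with its pointwise values: `b x` is the
limit, as `r → 0⁺`, of the mean density of `B_c[Φ⁺]` on the ball of radius `r` about `x`.  This is a
version of the density (Lebesgue differentiation), and it is the continuous one near every point
that has a neighbourhood on which a continuous version exists. -/
def density [Finite ι] [MeasurableSpace V] [BorelSpace V] [P.IsRootSystem] (Δ : P.Base) (x : V) :
    ℝ :=
  limUnder (𝓝[>] (0 : ℝ)) fun r =>
    (boxSpline Δ).real (Metric.closedBall x r) / (latticeVolume Δ).real (Metric.closedBall x r)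

/-- The convolution `𝒯 m = b * ∑_{ν ∈ Q} m(ν) δ_ν`, for `m : Q → ℂ`.  At every point the sum has
only finitely many nonzero terms, because `b` has bounded support. -/
def boxConv [Finite ι] [MeasurableSpace V] [BorelSpace V] [P.IsRootSystem] (Δ : P.Base)
    (m : rootLattice P → ℂ) (γ : V) : ℂ :=
  ∑ᶠ ν : rootLattice P, m ν * (density Δ (γ - ν) : ℂ)

/-- The algebra `Π(V)` of complex-valued polynomial functions on the real vector space `V`: the
algebra of functions generated over `ℂ` by the real linear functionals. -/
def polyFun (V : Type*) [AddCommGroup V] [Module ℝ V] : Subalgebra ℂ (V → ℂ) :=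
  Algebra.adjoin ℂ {f | ∃ φ : Module.Dual ℝ V, f = fun x => (φ x : ℂ)}

/-- The space `D(Φ⁺)` of the polynomial functions in the image of `𝒯`.  As `𝒯` takes values in
`L¹_loc`, the equality `p = 𝒯 m` is one of locally integrable functions, i.e. almost everywhere. -/
def dmSpace [Finite ι] [MeasurableSpace V] [BorelSpace V] [P.IsRootSystem] (Δ : P.Base) :
    Set (V → ℂ) :=
  {p | p ∈ polyFun V ∧ ∃ m : rootLattice P → ℂ, p =ᵐ[latticeVolume Δ] boxConv Δ m}

/-- The directional derivative `∂_v f`. -/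
def dirDeriv (v : V) (f : V → ℂ) : V → ℂ := fun x => lineDeriv ℝ f x v

/-- The coefficient `(2^{1-2n} - 1) B_{2n} / (2n)!` of `z^{2n}` in the Taylor series of
`z / (e^{z/2} - e^{-z/2})`. -/
def aCoeff (n : ℕ) : ℂ :=
  ((2 : ℂ) ^ (1 - 2 * (n : ℤ)) - 1) * (bernoulli (2 * n) : ℂ) / ((2 * n).factorial : ℂ)

/-- The operator `∂^{2n} = ∏_{α ∈ Φ⁺} ∂_α^{2 n_α}` for a multi-index `n`: the composition of the
`∂_α^{2 n_α}` over a list of the positive roots, each occurring once.  On smooth functions the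
factors commute and their order is immaterial. -/
def multiDeriv [Finite ι] (Δ : P.Base) (n : PosRoot Δ → ℕ) (f : V → ℂ) : V → ℂ :=
  (Finset.univ : Finset (PosRoot Δ)).toList.foldr
    (fun (α : PosRoot Δ) g => (dirDeriv (P.root α))^[2 * n α] g) f

/-- The term of multi-index `n` of the series `Â(Φ⁺) f`. -/
def ahatTerm [Finite ι] (Δ : P.Base) (n : PosRoot Δ → ℕ) (f : V → ℂ) : V → ℂ :=
  fun x => (∏ α : PosRoot Δ, aCoeff (n α)) * multiDeriv Δ n f x

/-- The infinite-order differential operator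
`Â(Φ⁺) = ∏_α ∂_α / (e^{∂_α/2} - e^{-∂_α/2})`, as a series over all multi-indices. -/
def ahat [Finite ι] (Δ : P.Base) (f : V → ℂ) : V → ℂ :=
  fun x => ∑' n : PosRoot Δ → ℕ, ahatTerm Δ n f x

/-- The forward difference `Δ_τ f`. -/
def fwd (τ : V) (f : V → ℂ) : V → ℂ := fun x => f (x + τ) - f x

/-- The backward difference `∇_τ f`. -/
def bwd (τ : V) (f : V → ℂ) : V → ℂ := fun x => f x - f (x - τ)

/-- The box spline Laplacian `𝒟 = ∑_{τ ∈ Q} b(τ) ∇_τ Δ_τ`, a finite sum because `b` has bounded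
support. -/
def laplacian [Finite ι] [MeasurableSpace V] [BorelSpace V] [P.IsRootSystem] (Δ : P.Base)
    (f : V → ℂ) : V → ℂ :=
  fun x => ∑ᶠ τ : rootLattice P, (density Δ (τ : V) : ℂ) * bwd (τ : V) (fwd (τ : V) f) x

end BoxSpline

end

/-!
Write `B` for the box spline of the positive roots, `E p x = ∫ p (x + y) dB(y)` for averaging against
it, and `b` for its density. The theorem follows from two descriptions of `E` on `D(Φ⁺)`.

*As a differential operator.* `E` is the composition over the positive roots of the averages over
segments of direction `α`. By Taylor's formula such an average is
`(e^{∂_α/2} - e^{-∂_α/2}) / ∂_α` on polynomials, and the generating function of the Bernoulli numbers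
provides the inverse series, so that `Â E = 1` on polynomials (`ahat_boxAvg`).

*As a sum over the root lattice.* Poisson summation gives
`∑ τ, b τ * q τ = ∫ q dB` for `q` in `D(Φ⁺)` (`finsum_boxDensity_mul`). For the functions
`q y = p (x + y) + p (x - y) - 2 p x` this reads `𝒟 = 2 (E - 1)` on `D(Φ⁺)`, because `B` is even
(`neg_half_laplacian_eq`).

Members of `D(Φ⁺)` have degree at most `d` (`IsDM.degLT`) and `𝒟` lowers the degree by two, so the
Neumann series `∑ (1 - E)^k p = ∑ (-𝒟/2)^k p` breaks off after `k = ⌊d/2⌋` with a function that `E`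
sends to `p` (`boxAvg_neumann_sum`); applying `Â` proves the claim.

Poisson summation rests on the description of `D(Φ⁺)` by Dahmen and Micchelli: its members are killed
by `∏ α ∈ C, ∂_α` whenever the roots outside `C` do not span. Here this is the predicate `IsDM`, which
unfolds the condition one derivative at a time and makes sense for every subfamily `A` of the roots.
That a polynomial `𝒯 m` satisfies it is `isDM_of_mem_span`: as a distribution, `∂_α` of the box spline
of `A` is a difference of two translates of the box spline of `A \ {α}`, and once the family no
longer spans, the distribution is carried by a null set.

For a nonzero character `ξ` of `V/Q` and `q` in the space of `A`, the integral of `e_ξ q` against the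
box spline of `A` vanishes (`boxAvg_expChar_mul`), by the same difference formula and induction on `A`
and on the degree of `q`. Hence a trigonometric polynomial integrates against `q B` to its mean times
the integral of `q`, and the powers of `∏ cos²(π x_s)`, which concentrate on the lattice, turn this
into the lattice sum.

The last step needs `b` to be continuous at the lattice points. Splitting off the simple roots, whose
box spline is the indicator function of a parallelepiped, gives a formula for a version of the density
(`boxDensity`) that is continuous at all points whose coordinates avoid `±1/2`
(`continuousAt_boxDensity`). These points include the lattice and almost every point, and at each of
them the formula agrees with the limit of the mean densities on balls.
-/

noncomputable section

namespace BoxSpline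

open scoped ContDiff

/-! ### Directional derivatives of analytic functions -/

section Calculus

variable {V : Type*} [NormedAddCommGroup V] [InnerProductSpace ℝ V]

lemma dirDeriv_apply {f : V → ℂ} (hf : Differentiable ℝ f) (v x : V) :
    dirDeriv v f x = fderiv ℝ f x v := (hf x).lineDeriv_eq_fderiv

lemma contDiff_dirDeriv {n m : WithTop ℕ∞} {f : V → ℂ} (hf : ContDiff ℝ n f) (hn : m + 1 ≤ n)
    (v : V) : ContDiff ℝ m (dirDeriv v f) := by
  have h1 : (1 : WithTop ℕ∞) ≤ n := le_trans (by simp) hn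
  have : dirDeriv v f = fun x => fderiv ℝ f x v :=
    funext fun x => dirDeriv_apply (hf.differentiable (by rintro rfl; simp at h1)) v x
  rw [this]
  exact (hf.fderiv_right hn).clm_apply contDiff_const

lemma contDiff_omega_dirDeriv {f : V → ℂ} (hf : ContDiff ℝ ω f) (v : V) :
    ContDiff ℝ ω (dirDeriv v f) := contDiff_dirDeriv hf le_rfl v

lemma dirDeriv_add {f g : V → ℂ} (hf : Differentiable ℝ f) (hg : Differentiable ℝ g) (v : V) :
    dirDeriv v (f + g) = dirDeriv v f + dirDeriv v g := by
  ext x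
  rw [Pi.add_apply, dirDeriv_apply (hf.add hg), dirDeriv_apply hf, dirDeriv_apply hg,
    fderiv_add (hf x) (hg x)]
  rfl

lemma dirDeriv_smul {f : V → ℂ} (hf : Differentiable ℝ f) (c : ℂ) (v : V) :
    dirDeriv v (c • f) = c • dirDeriv v f := by
  ext x
  rw [Pi.smul_apply, dirDeriv_apply (hf.const_smul c), dirDeriv_apply hf,
    fderiv_const_smul (hf x)]
  rfl

lemma dirDeriv_zero (v : V) : dirDeriv v (0 : V → ℂ) = 0 := by
  ext x
  simp [dirDeriv, lineDeriv]

lemma dirDeriv_const (v : V) (c : ℂ) : dirDeriv v (fun _ : V => c) = 0 := by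
  ext x
  simp [dirDeriv, lineDeriv]

lemma dirDeriv_comp_add (f : V → ℂ) (v w : V) :
    dirDeriv v (fun x => f (x + w)) = fun x => dirDeriv v f (x + w) := by
  ext x
  simp [dirDeriv, lineDeriv, add_right_comm]

lemma dirDeriv_comm {f : V → ℂ} (hf : ContDiff ℝ 2 f) (v w : V) :
    dirDeriv v (dirDeriv w f) = dirDeriv w (dirDeriv v f) := by
  have hd : Differentiable ℝ f := hf.differentiable (by simp)
  have h1 (u : V) : dirDeriv u f = fun x => fderiv ℝ f x u :=
    funext fun x => dirDeriv_apply hd u x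
  have hdd (u : V) : Differentiable ℝ (dirDeriv u f) :=
    (contDiff_dirDeriv (m := 1) hf (by norm_num) u).differentiable (by simp)
  have hf' : Differentiable ℝ (fderiv ℝ f) :=
    (hf.fderiv_right (m := 1) (by norm_num)).differentiable (by simp)
  ext x
  rw [dirDeriv_apply (hdd w), dirDeriv_apply (hdd v), h1, h1,
    fderiv_clm_apply (hf' x) (by fun_prop), fderiv_clm_apply (hf' x) (by fun_prop)]
  simp
  exact (hf.contDiffAt.isSymmSndFDerivAt (by simp)) v w

lemma dirDeriv_comm_omega {f : V → ℂ} (hf : ContDiff ℝ ω f) (v w : V) :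
    dirDeriv v (dirDeriv w f) = dirDeriv w (dirDeriv v f) :=
  dirDeriv_comm (hf.of_le le_top) v w

/-- Differentiation along the line `t ↦ x + t v`. -/
lemma hasDerivAt_line {f : V → ℂ} (hf : Differentiable ℝ f) (x v : V) (t : ℝ) :
    HasDerivAt (fun t : ℝ => f (x + t • v)) (dirDeriv v f (x + t • v)) t := by
  rw [dirDeriv_apply hf]
  have h : HasDerivAt (fun t : ℝ => x + t • v) v t := by
    simpa using ((hasDerivAt_id t).smul_const v).const_add x
  exact (hf (x + t • v)).hasFDerivAt.comp_hasDerivAt t h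

/-- A function whose derivative in the direction `v` vanishes is constant along `v`. -/
lemma apply_add_smul_of_dirDeriv_eq_zero {f : V → ℂ} (hf : Differentiable ℝ f) {v : V}
    (h : dirDeriv v f = 0) (x : V) (t : ℝ) : f (x + t • v) = f x := by
  have := is_const_of_deriv_eq_zero (f := fun t : ℝ => f (x + t • v))
    (fun t => (hasDerivAt_line hf x v t).differentiableAt)
    (fun t => by rw [(hasDerivAt_line hf x v t).deriv, h]; rfl) t 0
  simpa using this

lemma dirDeriv_sum_smul {f : V → ℂ} (hf : Differentiable ℝ f) {κ : Type*} (s : Finset κ)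
    (c : κ → ℝ) (v : κ → V) :
    dirDeriv (∑ k ∈ s, c k • v k) f = ∑ k ∈ s, (c k : ℂ) • dirDeriv (v k) f := by
  ext x
  simp [dirDeriv_apply hf]

lemma dirDeriv_mul {f g : V → ℂ} (hf : Differentiable ℝ f) (hg : Differentiable ℝ g) (v : V) :
    dirDeriv v (f * g) = f * dirDeriv v g + dirDeriv v f * g := by
  ext x
  rw [dirDeriv_apply (hf.mul hg), fderiv_mul (hf x) (hg x)]
  simp [dirDeriv_apply hf, dirDeriv_apply hg, mul_comm]

/-- The fundamental theorem of calculus along a segment of direction `v`, centered at `x`. -/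
lemma integral_dirDeriv_segment {f : V → ℂ} (hf : ContDiff ℝ 1 f) (x v : V) :
    ∫ s in Set.Icc (-(1 / 2) : ℝ) (1 / 2), dirDeriv v f (x + s • v) =
      f (x + (1 / 2 : ℝ) • v) - f (x - (1 / 2 : ℝ) • v) := by
  have hd : Differentiable ℝ f := hf.differentiable (by simp)
  have hc : Continuous (dirDeriv v f) :=
    (contDiff_dirDeriv (m := 0) hf (by norm_num) v).continuous
  rw [integral_Icc_eq_integral_Ioc, ← intervalIntegral.integral_of_le (by norm_num),
    intervalIntegral.integral_eq_sub_of_hasDerivAt (fun t _ => hasDerivAt_line hd x v t)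
      (by apply Continuous.intervalIntegrable; fun_prop)]
  simp [sub_eq_add_neg]

/-- The function `f` is annihilated by all products of `k` directional derivatives; for smooth
functions this says that `f` is a polynomial of degree less than `k`. -/
def DegLT : ℕ → (V → ℂ) → Prop
  | 0, f => f = 0
  | k + 1, f => ∀ v : V, DegLT k (dirDeriv v f)

lemma DegLT.zero_fun : ∀ k : ℕ, DegLT k (0 : V → ℂ)
  | 0 => rfl
  | k + 1 => fun v => by rw [dirDeriv_zero]; exact DegLT.zero_fun k

lemma DegLT.succ {k : ℕ} {f : V → ℂ} (h : DegLT k f) : DegLT (k + 1) f := by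
  induction k generalizing f with
  | zero => intro v; rw [show f = 0 from h, dirDeriv_zero]; rfl
  | succ k ih => exact fun v => ih (h v)

lemma DegLT.mono {k l : ℕ} {f : V → ℂ} (h : DegLT k f) (hkl : k ≤ l) : DegLT l f := by
  induction hkl with
  | refl => exact h
  | step _ ih => exact ih.succ

lemma DegLT.add {k : ℕ} {f g : V → ℂ} (hf : ContDiff ℝ ω f) (hg : ContDiff ℝ ω g)
    (h : DegLT k f) (h' : DegLT k g) : DegLT k (f + g) := by
  induction k generalizing f g with
  | zero => rw [show f = 0 from h, show g = 0 from h', add_zero]; rfl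
  | succ k ih =>
    intro v
    rw [dirDeriv_add (hf.differentiable (by simp)) (hg.differentiable (by simp))]
    exact ih (contDiff_omega_dirDeriv hf v) (contDiff_omega_dirDeriv hg v) (h v) (h' v)

lemma DegLT.smul {k : ℕ} {f : V → ℂ} (hf : ContDiff ℝ ω f) (h : DegLT k f) (c : ℂ) :
    DegLT k (c • f) := by
  induction k generalizing f with
  | zero => rw [show f = 0 from h, smul_zero]; rfl
  | succ k ih =>
    intro v
    rw [dirDeriv_smul (hf.differentiable (by simp))]
    exact ih (contDiff_omega_dirDeriv hf v) (h v)

lemma DegLT.sum {k : ℕ} {κ : Type*} (s : Finset κ) {f : κ → V → ℂ}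
    (hf : ∀ j ∈ s, ContDiff ℝ ω (f j)) (h : ∀ j ∈ s, DegLT k (f j)) :
    DegLT k (∑ j ∈ s, f j) := by
  classical
  induction s using Finset.induction_on with
  | empty => exact DegLT.zero_fun k
  | insert a s ha ih =>
    rw [Finset.sum_insert ha]
    simp only [Finset.mem_insert, forall_eq_or_imp] at hf h
    refine DegLT.add hf.1 ?_ h.1 (ih hf.2 h.2)
    have : ∑ j ∈ s, f j = fun x => ∑ j ∈ s, f j x := by ext; simp
    rw [this]
    exact ContDiff.sum hf.2

lemma fwd_eq (τ : V) (f : V → ℂ) : fwd τ f = (fun x => f (x + τ)) + (-1 : ℂ) • f := by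
  ext x; simp [fwd, sub_eq_add_neg]

lemma contDiff_fwd {f : V → ℂ} (hf : ContDiff ℝ ω f) (τ : V) : ContDiff ℝ ω (fwd τ f) := by
  unfold BoxSpline.fwd; fun_prop

lemma dirDeriv_fwd {f : V → ℂ} (hf : Differentiable ℝ f) (v τ : V) :
    dirDeriv v (fwd τ f) = fwd τ (dirDeriv v f) := by
  rw [fwd_eq, dirDeriv_add (by fun_prop) (by fun_prop), dirDeriv_smul hf, dirDeriv_comp_add,
    ← fwd_eq]

lemma DegLT.fwd {k : ℕ} {f : V → ℂ} (hf : ContDiff ℝ ω f) (h : DegLT k f) (τ : V) :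
    DegLT (k - 1) (fwd τ f) := by
  have hd : Differentiable ℝ f := hf.differentiable (by simp)
  match k with
  | 0 =>
    rw [show f = 0 from h, show BoxSpline.fwd τ (0 : V → ℂ) = 0 by ext; simp [BoxSpline.fwd]]
    exact DegLT.zero_fun _
  | 1 =>
    show BoxSpline.fwd τ f = 0
    ext x
    have := apply_add_smul_of_dirDeriv_eq_zero hd (h τ) x 1
    rw [one_smul] at this
    simp [BoxSpline.fwd, this]
  | k + 2 =>
    intro v
    rw [dirDeriv_fwd hd]
    exact (h v).fwd (contDiff_omega_dirDeriv hf v) τ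

lemma DegLT.comp_add {k : ℕ} {f : V → ℂ} (h : DegLT k f) (w : V) :
    DegLT k (fun x => f (x + w)) := by
  induction k generalizing f with
  | zero => rw [show f = 0 from h]; rfl
  | succ k ih => intro v; rw [dirDeriv_comp_add]; exact ih (h v)

lemma DegLT.iterate_dirDeriv {k : ℕ} {f : V → ℂ} (h : DegLT k f) (v : V) :
    (dirDeriv v)^[k] f = 0 := by
  induction k generalizing f with
  | zero => exact h
  | succ k ih => rw [Function.iterate_succ_apply]; exact ih (h v)

lemma bwd_eq (τ : V) (f : V → ℂ) : bwd τ f = fun x => fwd τ f (x + -τ) := by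
  ext x; simp [bwd, fwd, sub_eq_add_neg]

lemma DegLT.bwd {k : ℕ} {f : V → ℂ} (hf : ContDiff ℝ ω f) (h : DegLT k f) (τ : V) :
    DegLT (k - 1) (bwd τ f) := by
  rw [bwd_eq]; exact (h.fwd hf τ).comp_add _

lemma contDiff_bwd {f : V → ℂ} (hf : ContDiff ℝ ω f) (τ : V) : ContDiff ℝ ω (bwd τ f) := by
  unfold BoxSpline.bwd; fun_prop

/-- Real-valued linear functionals are real analytic, hence so are all polynomial functions. -/
lemma contDiff_of_mem_polyFun [FiniteDimensional ℝ V] {p : V → ℂ} (hp : p ∈ polyFun V) :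
    ContDiff ℝ ω p := by
  unfold polyFun at hp
  induction hp using Algebra.adjoin_induction with
  | mem f hf =>
    obtain ⟨φ, rfl⟩ := hf
    exact Complex.ofRealCLM.contDiff.comp (LinearMap.toContinuousLinearMap φ).contDiff
  | algebraMap c => exact contDiff_const
  | add f g _ _ hf hg => exact hf.add hg
  | mul f g _ _ hf hg => exact hf.mul hg

/-- The identity theorem: an analytic function that vanishes on a nonempty open set is zero. -/
lemma eq_zero_of_eqOn_open {f : V → ℂ} (hf : ContDiff ℝ ω f) {U : Set V} (hU : IsOpen U)
    (hne : U.Nonempty) (h : ∀ x ∈ U, f x = 0) : f = 0 := by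
  obtain ⟨x, hx⟩ := hne
  have ha : AnalyticOnNhd ℝ f Set.univ := fun y _ => (hf.contDiffAt).analyticAt
  exact ha.eq_of_eventuallyEq (z₀ := x) (fun _ _ => analyticAt_const)
    (Filter.eventually_of_mem (hU.mem_nhds hx) h)

end Calculus

/-! ### Dahmen–Micchelli spaces -/

section DahmenMicchelli

variable {I V : Type*} [DecidableEq I] [NormedAddCommGroup V] [InnerProductSpace ℝ V]

/-- The Dahmen–Micchelli space of the subfamily `A` of a family of vectors `v`, as a predicate on
analytic functions: `q` is killed by `∏ α ∈ C, ∂_α` for every `C ⊆ A` such that `A \ C` does not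
span.  The condition is unfolded one derivative at a time: a non-spanning subfamily admits only
`q = 0`, and each `∂_α` with `α ∈ A` leads to the space of `A.erase α`. -/
inductive IsDM (v : I → V) : Finset I → (V → ℂ) → Prop
  | intro {A : Finset I} {q : V → ℂ} (smooth : ContDiff ℝ ω q)
      (eq_zero : Submodule.span ℝ (v '' A) ≠ ⊤ → q = 0)
      (deriv : ∀ α ∈ A, IsDM v (A.erase α) (dirDeriv (v α) q)) : IsDM v A q

namespace IsDM

variable {v : I → V} {A : Finset I} {q q' : V → ℂ}

lemma smooth (h : IsDM v A q) : ContDiff ℝ ω q := by cases h; assumption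

lemma differentiable (h : IsDM v A q) : Differentiable ℝ q := h.smooth.differentiable (by simp)

lemma eq_zero (h : IsDM v A q) (hA : Submodule.span ℝ (v '' A) ≠ ⊤) : q = 0 := by
  cases h with | intro _ h0 _ => exact h0 hA

lemma deriv_erase (h : IsDM v A q) {α : I} (hα : α ∈ A) :
    IsDM v (A.erase α) (dirDeriv (v α) q) := by
  cases h with | intro _ _ h1 => exact h1 α hα

lemma zero (v : I → V) (A : Finset I) : IsDM v A 0 := by
  induction A using Finset.strongInductionOn with
  | _ A ih =>
    refine ⟨contDiff_const, fun _ => rfl, fun α hα => ?_⟩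
    rw [dirDeriv_zero]
    exact ih _ (Finset.erase_ssubset hα)

lemma add (h : IsDM v A q) (h' : IsDM v A q') : IsDM v A (q + q') := by
  induction h generalizing q' with
  | intro hs h0 h1 ih =>
    refine ⟨hs.add h'.smooth, fun hA => by rw [h0 hA, h'.eq_zero hA, add_zero], fun α hα => ?_⟩
    rw [dirDeriv_add (hs.differentiable (by simp)) h'.differentiable]
    exact ih α hα (h'.deriv_erase hα)

lemma smul (h : IsDM v A q) (c : ℂ) : IsDM v A (c • q) := by
  induction h with
  | intro hs h0 h1 ih =>
    refine ⟨contDiff_const.smul hs, fun hA => by rw [h0 hA, smul_zero], fun α hα => ?_⟩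
    rw [dirDeriv_smul (hs.differentiable (by simp))]
    exact ih α hα

lemma sum {κ : Type*} (s : Finset κ) {f : κ → V → ℂ} (h : ∀ j ∈ s, IsDM v A (f j)) :
    IsDM v A (∑ j ∈ s, f j) := by
  classical
  induction s using Finset.induction_on with
  | empty => exact zero v A
  | insert a s ha ih =>
    rw [Finset.sum_insert ha]
    simp only [Finset.mem_insert, forall_eq_or_imp] at h
    exact h.1.add (ih h.2)

lemma dirDeriv (h : IsDM v A q) (w : V) : IsDM v A (dirDeriv w q) := by
  induction h with
  | intro hs h0 h1 ih =>
    refine ⟨contDiff_omega_dirDeriv hs w, fun hA => by rw [h0 hA, dirDeriv_zero], fun α hα => ?_⟩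
    rw [dirDeriv_comm_omega hs]
    exact ih α hα

lemma comp_add (h : IsDM v A q) (w : V) : IsDM v A (fun x => q (x + w)) := by
  induction h with
  | intro hs h0 h1 ih =>
    refine ⟨by fun_prop, fun hA => by rw [h0 hA]; rfl, fun α hα => ?_⟩
    rw [dirDeriv_comp_add]
    exact ih α hα

lemma comp_neg (h : IsDM v A q) : IsDM v A (fun x => q (-x)) := by
  induction h with
  | @intro A q hs h0 h1 ih =>
    refine ⟨by fun_prop, fun hA => by rw [h0 hA]; rfl, fun α hα => ?_⟩
    have : BoxSpline.dirDeriv (v α) (fun x => q (-x)) =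
        (-1 : ℂ) • fun x => BoxSpline.dirDeriv (v α) q (-x) := by
      have hd : Differentiable ℝ q := hs.differentiable (by simp)
      ext x
      have h1 : HasFDerivAt (fun x : V => q (-x)) ((fderiv ℝ q (-x)).comp (-.id ℝ V)) x :=
        (hd (-x)).hasFDerivAt.comp x (hasFDerivAt_id x).neg
      rw [dirDeriv_apply (by fun_prop), h1.fderiv, Pi.smul_apply, dirDeriv_apply hd]
      simp
    rw [this]
    exact (ih α hα).smul _

/-- Centered differences behave like derivatives: if `∂_w q` lies in the space of `A`, so does
`q(· + w/2) - q(· - w/2)`. -/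
lemma centralDiff {w : V} (hq : ContDiff ℝ ω q) (h : IsDM v A (BoxSpline.dirDeriv w q)) :
    IsDM v A (fun x => q (x + (1 / 2 : ℝ) • w) - q (x - (1 / 2 : ℝ) • w)) := by
  induction A using Finset.strongInductionOn generalizing q with
  | _ A ih =>
    have hd : Differentiable ℝ q := hq.differentiable (by simp)
    refine ⟨by fun_prop, fun hA => ?_, fun α hα => ?_⟩
    · ext x
      have := apply_add_smul_of_dirDeriv_eq_zero hd (h.eq_zero hA)
      have h2 := this x (-(1 / 2))
      rw [neg_smul, ← sub_eq_add_neg] at h2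
      rw [this, h2]
      simp
    · have e : BoxSpline.dirDeriv (v α)
          (fun x => q (x + (1 / 2 : ℝ) • w) - q (x - (1 / 2 : ℝ) • w)) =
          fun x => BoxSpline.dirDeriv (v α) q (x + (1 / 2 : ℝ) • w) -
            BoxSpline.dirDeriv (v α) q (x - (1 / 2 : ℝ) • w) := by
        have e1 : (fun x => q (x + (1 / 2 : ℝ) • w) - q (x - (1 / 2 : ℝ) • w)) =
            (fun x => q (x + (1 / 2 : ℝ) • w)) + (-1 : ℂ) • fun x => q (x + -((1 / 2 : ℝ) • w)) := by
          ext x; simp [sub_eq_add_neg]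
        rw [e1, dirDeriv_add (by fun_prop) (by fun_prop), dirDeriv_smul (by fun_prop),
          dirDeriv_comp_add, dirDeriv_comp_add]
        ext x; simp [sub_eq_add_neg]
      rw [e]
      refine ih _ (Finset.erase_ssubset hα) (contDiff_omega_dirDeriv hq _) ?_
      rw [dirDeriv_comm_omega hq]
      exact h.deriv_erase hα

lemma const (hA : Submodule.span ℝ (v '' A) = ⊤) (c : ℂ) : IsDM v A (fun _ => c) := by
  refine ⟨contDiff_const, fun h => absurd hA h, fun α _ => ?_⟩
  rw [dirDeriv_const]
  exact zero v _

/-- The degree bound: members of the Dahmen–Micchelli space of `A` are polynomials of degree at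
most `|A| - dim V`. -/
lemma degLT [FiniteDimensional ℝ V] (h : IsDM v A q) :
    DegLT (A.card + 1 - Module.finrank ℝ V) q := by
  induction h with
  | @intro A q hs h0 h1 ih =>
    by_cases hA : Submodule.span ℝ (v '' A) = ⊤
    · have hcard : Module.finrank ℝ V ≤ A.card := by
        classical
        have := finrank_span_finset_le_card (R := ℝ) (A.image v)
        rw [Finset.coe_image, Set.finrank, hA, finrank_top] at this
        exact this.trans Finset.card_image_le
      rw [Nat.sub_add_comm hcard]
      intro w
      have hw : w ∈ Submodule.span ℝ (v '' A) := hA ▸ Submodule.mem_top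
      rw [Submodule.mem_span_image_finset_iff_exists_fun] at hw
      obtain ⟨c, rfl⟩ := hw
      rw [dirDeriv_sum_smul (hs.differentiable (by simp))]
      refine DegLT.sum _ (fun j _ => contDiff_const.smul (contDiff_omega_dirDeriv hs _))
        fun j _ => DegLT.smul (contDiff_omega_dirDeriv hs _) ?_ _
      have := ih j j.2
      rwa [Finset.card_erase_add_one j.2] at this
    · rw [h0 hA]
      exact DegLT.zero_fun _

end IsDM
end DahmenMicchelli

/-! ### Averaging over the cube -/

section Cube

variable {I V : Type*} [Fintype I]

/-- The uniform probability measure on the cube `[-1/2, 1/2]^I`. -/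
def cube (I : Type*) [Fintype I] : Measure (I → ℝ) :=
  Measure.pi fun _ : I => (volume : Measure ℝ).restrict (Set.Icc (-(1 / 2)) (1 / 2))

lemma isProbabilityMeasure_restrict_Icc :
    IsProbabilityMeasure ((volume : Measure ℝ).restrict (Set.Icc (-(1 / 2)) (1 / 2))) :=
  ⟨by simp; norm_num⟩

instance : IsProbabilityMeasure (cube I) := by
  have := isProbabilityMeasure_restrict_Icc
  unfold cube
  infer_instance

lemma cube_eq_restrict :
    cube I = volume.restrict (Set.univ.pi fun _ : I => Set.Icc (-(1 / 2) : ℝ) (1 / 2)) :=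
  (Measure.restrict_pi_pi _ _).symm

lemma ae_mem_cube : ∀ᵐ t ∂cube I, ∀ i, t i ∈ Set.Icc (-(1 / 2) : ℝ) (1 / 2) := by
  rw [cube_eq_restrict]
  filter_upwards [ae_restrict_mem (MeasurableSet.univ_pi fun _ => measurableSet_Icc)] with t ht i
  exact ht i trivial

lemma integrable_cube {E : Type*} [NormedAddCommGroup E] {F : (I → ℝ) → E} (hF : Continuous F) :
    Integrable F (cube I) := by
  rw [cube_eq_restrict]
  exact hF.continuousOn.integrableOn_compact (isCompact_univ_pi fun _ => isCompact_Icc)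

/-- Resampling one coordinate preserves the uniform measure on the cube. -/
lemma measurePreserving_update [DecidableEq I] (i : I) :
    MeasurePreserving (fun z : (I → ℝ) × ℝ => Function.update z.1 i z.2)
      ((cube I).prod (volume.restrict (Set.Icc (-(1 / 2)) (1 / 2)))) (cube I) := by
  have hm : Measurable fun z : (I → ℝ) × ℝ => Function.update z.1 i z.2 := by
    refine measurable_pi_iff.2 fun j => ?_
    by_cases h : j = i
    · subst h; simpa using measurable_snd
    · simp only [Function.update_of_ne h]
      fun_prop
  refine ⟨hm, ?_⟩
  have := isProbabilityMeasure_restrict_Icc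
  refine (Measure.pi_eq fun s hs => ?_).symm
  rw [Measure.map_apply hm (MeasurableSet.univ_pi hs)]
  have : (fun z : (I → ℝ) × ℝ => Function.update z.1 i z.2) ⁻¹' Set.univ.pi s =
      (Set.univ.pi (Function.update s i Set.univ)) ×ˢ s i := by
    ext ⟨t, u⟩
    simp only [Set.mem_preimage, Set.mem_pi, Set.mem_univ, true_imp_iff, Set.mem_prod]
    constructor
    · intro h
      refine ⟨fun j => ?_, by simpa using h i⟩
      by_cases hj : j = i
      · subst hj; simp
      · simpa [hj] using h j
    · rintro ⟨h1, h2⟩ j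
      by_cases hj : j = i
      · subst hj; simpa using h2
      · simpa [hj] using h1 j
  rw [this, Measure.prod_prod, cube, Measure.pi_pi,
    ← Finset.mul_prod_erase _ _ (Finset.mem_univ i), ← Finset.mul_prod_erase _ _ (Finset.mem_univ i),
    Function.update_self, measure_univ, one_mul, mul_comm]
  congr 1
  exact Finset.prod_congr rfl fun j hj => by rw [Function.update_of_ne (Finset.ne_of_mem_erase hj)]

lemma integral_cube_update [DecidableEq I] (i : I) {E : Type*} [NormedAddCommGroup E]
    [NormedSpace ℝ E] {F : (I → ℝ) → E} (hF : Continuous F) :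
    ∫ t, F t ∂cube I =
      ∫ t, (∫ s in Set.Icc (-(1 / 2) : ℝ) (1 / 2), F (Function.update t i s)) ∂cube I := by
  have hp := measurePreserving_update i
  have := isProbabilityMeasure_restrict_Icc
  rw [← integral_prod (f := fun z : (I → ℝ) × ℝ => F (Function.update z.1 i z.2)),
    ← hp.map_eq, integral_map hp.measurable.aemeasurable, hp.map_eq]
  · exact hF.aestronglyMeasurable
  · exact (hp.integrable_comp hF.aestronglyMeasurable).2 (integrable_cube hF)

lemma measurePreserving_neg_cube : MeasurePreserving (fun t : I → ℝ => -t) (cube I) (cube I) := by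
  have := isProbabilityMeasure_restrict_Icc
  refine measurePreserving_pi _ _ (f := fun _ => (Neg.neg : ℝ → ℝ)) fun _ => ?_
  have := (Measure.measurePreserving_neg (volume : Measure ℝ)).restrict_preimage
    (s := Set.Icc (-(1 / 2)) (1 / 2)) measurableSet_Icc
  simpa using this

variable [NormedAddCommGroup V] [InnerProductSpace ℝ V]

/-- The average of `f` against the translate to `x` of the centered box spline of the subfamily `A`
of `v`.  All coordinates of the cube are integrated, those outside `A` trivially. -/
def boxAvg (v : I → V) (A : Finset I) (f : V → ℂ) (x : V) : ℂ :=
  ∫ t, f (x + ∑ i ∈ A, t i • v i) ∂cube I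

variable {v : I → V} {A : Finset I} {f : V → ℂ}

lemma boxAvg_eq_erase [DecidableEq I] (hf : Continuous f) {i : I} (hi : i ∈ A) (x : V) :
    boxAvg v A f x = boxAvg v (A.erase i)
      (fun y => ∫ s in Set.Icc (-(1 / 2) : ℝ) (1 / 2), f (y + s • v i)) x := by
  unfold boxAvg
  rw [integral_cube_update i (by fun_prop)]
  refine integral_congr_ae (.of_forall fun t => integral_congr_ae (.of_forall fun s => ?_))
  dsimp only
  rw [← Finset.sum_erase_add _ _ hi, Function.update_self, add_assoc]
  congr 3
  exact Finset.sum_congr rfl fun j hj => by rw [Function.update_of_ne (Finset.ne_of_mem_erase hj)]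

/-- In the sense of distributions, `∂_α` turns the box spline of `A` into the centered difference in
the direction `α` of the box spline of `A.erase α`. -/
lemma boxAvg_dirDeriv [DecidableEq I] (hf : ContDiff ℝ 1 f) {i : I} (hi : i ∈ A) (x : V) :
    boxAvg v A (dirDeriv (v i) f) x =
      boxAvg v (A.erase i) (fun y => f (y + (1 / 2 : ℝ) • v i) - f (y - (1 / 2 : ℝ) • v i)) x := by
  rw [boxAvg_eq_erase (contDiff_dirDeriv (m := 0) hf (by norm_num) _).continuous hi]
  congr 1 with y
  exact integral_dirDeriv_segment hf y (v i)

lemma boxAvg_add {g : V → ℂ} (hf : Continuous f) (hg : Continuous g) (x : V) :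
    boxAvg v A (f + g) x = boxAvg v A f x + boxAvg v A g x := by
  unfold boxAvg
  exact integral_add (integrable_cube (by fun_prop)) (integrable_cube (by fun_prop))

lemma boxAvg_sub {g : V → ℂ} (hf : Continuous f) (hg : Continuous g) (x : V) :
    boxAvg v A (fun y => f y - g y) x = boxAvg v A f x - boxAvg v A g x := by
  unfold boxAvg
  exact integral_sub (integrable_cube (by fun_prop)) (integrable_cube (by fun_prop))

lemma boxAvg_smul (c : ℂ) (x : V) : boxAvg v A (c • f) x = c * boxAvg v A f x := by
  unfold boxAvg
  exact integral_const_mul _ _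

lemma boxAvg_comp_add (w x : V) :
    boxAvg v A (fun y => f (y + w)) x = boxAvg v A f (x + w) := by
  unfold boxAvg
  simp only [add_right_comm]

lemma boxAvg_comp_neg (x : V) : boxAvg v A (fun y => f (-y)) x = boxAvg v A f (-x) := by
  unfold boxAvg
  rw [← measurePreserving_neg_cube.integral_comp (Homeomorph.neg _).measurableEmbedding
    (fun t => f (-x + ∑ i ∈ A, t i • v i))]
  simp [add_comm]

end Cube

/-! ### Fourier transforms of box splines -/

section Character

variable {I V : Type*} [Fintype I] [DecidableEq I] [NormedAddCommGroup V] [InnerProductSpace ℝ V]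

/-- The character `x ↦ e^{2πi ξ(x)}` of `V`. -/
def expChar (ξ : V →L[ℝ] ℝ) (x : V) : ℂ := Complex.exp (2 * Real.pi * Complex.I * ξ x)

lemma expChar_add_apply (ξ : V →L[ℝ] ℝ) (x y : V) :
    expChar ξ (x + y) = expChar ξ x * expChar ξ y := by
  simp [expChar, mul_add, Complex.exp_add]

lemma contDiff_expChar (ξ : V →L[ℝ] ℝ) : ContDiff ℝ ω (expChar ξ) := by
  unfold expChar
  have : ContDiff ℝ ω fun x => (ξ x : ℂ) := Complex.ofRealCLM.contDiff.comp ξ.contDiff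
  exact (contDiff_const.mul this).cexp

lemma expChar_eq_one {ξ : V →L[ℝ] ℝ} {x : V} (h : ∃ n : ℤ, ξ x = n) : expChar ξ x = 1 := by
  obtain ⟨n, hn⟩ := h
  rw [expChar, hn, Complex.exp_eq_one_iff]
  exact ⟨n, by push_cast; ring⟩

lemma dirDeriv_expChar (ξ : V →L[ℝ] ℝ) (v : V) :
    dirDeriv v (expChar ξ) = (2 * Real.pi * Complex.I * ξ v : ℂ) • expChar ξ := by
  ext x
  have h1 : HasDerivAt (fun t : ℝ => (ξ (x + t • v) : ℂ)) (ξ v) 0 := by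
    have : HasDerivAt (fun t : ℝ => ξ (x + t • v)) (ξ v) 0 := by
      simpa using (((hasDerivAt_id (0 : ℝ)).mul_const (ξ v)).const_add (ξ x))
    exact this.ofReal_comp
  have h2 := (h1.const_mul (2 * Real.pi * Complex.I)).cexp
  rw [dirDeriv, lineDeriv]
  unfold expChar
  rw [h2.deriv]
  simp [mul_comm]

/-- The Fourier transform of `q · B_A` vanishes at every nonzero `ξ` that is integral on `A`, for
`q` in the Dahmen–Micchelli space of `A`.  Integrating `∂_α(e_ξ q)` against the box spline, with
`ξ(α) ≠ 0`, leads on the right to a centered difference of `q` and to the subfamily `A.erase α`, and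
on the left to `2πi ξ(α)` times the wanted integral plus that of `∂_α q`, of lower degree. -/
theorem boxAvg_expChar_mul [FiniteDimensional ℝ V] {v : I → V} {ξ : V →L[ℝ] ℝ} (hξ : ξ ≠ 0)
    (A : Finset I) (hint : ∀ i ∈ A, ∃ n : ℤ, ξ (v i) = n) {q : V → ℂ} (hq : IsDM v A q) :
    boxAvg v A (expChar ξ * q) 0 = 0 := by
  induction A using Finset.strongInductionOn generalizing q with
  | _ A ih =>
    by_cases hA : Submodule.span ℝ (v '' A) = ⊤
    swap
    · rw [hq.eq_zero hA, mul_zero]; simp [boxAvg]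
    obtain ⟨α, hα, hne⟩ : ∃ α ∈ A, ξ (v α) ≠ 0 := by
      by_contra! h
      refine hξ (ContinuousLinearMap.ext fun x => ?_)
      have hx : x ∈ Submodule.span ℝ (v '' A) := hA ▸ Submodule.mem_top
      induction hx using Submodule.span_induction with
      | mem x hx => obtain ⟨i, hi, rfl⟩ := hx; exact h i hi
      | zero => simp
      | add x y _ _ hx hy => simp_all
      | smul c x _ hx => simp_all
    have key (q : V → ℂ) (hq : IsDM v A q) :
        (2 * Real.pi * Complex.I * ξ (v α)) * boxAvg v A (expChar ξ * q) 0 +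
          boxAvg v A (expChar ξ * dirDeriv (v α) q) 0 = 0 := by
      have hξd : Differentiable ℝ (expChar ξ) := (contDiff_expChar ξ).differentiable (by simp)
      have hc := hq.smooth.continuous
      have hcd := (hq.dirDeriv (v α)).smooth.continuous
      have hcξ := (contDiff_expChar ξ).continuous
      have h := boxAvg_dirDeriv (v := v) (f := expChar ξ * q)
        (((contDiff_expChar ξ).mul hq.smooth).of_le le_top) hα 0
      rw [dirDeriv_mul hξd hq.differentiable, boxAvg_add (hcξ.mul hcd)
        (((contDiff_omega_dirDeriv (contDiff_expChar ξ) _).continuous).mul hc),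
        dirDeriv_expChar, smul_mul_assoc, boxAvg_smul, add_comm] at h
      rw [h]
      have e : (fun y => (expChar ξ * q) (y + (1 / 2 : ℝ) • v α) -
          (expChar ξ * q) (y - (1 / 2 : ℝ) • v α)) = expChar ξ ((1 / 2 : ℝ) • v α) •
          (expChar ξ * fun y => q (y + (1 / 2 : ℝ) • v α) - q (y - (1 / 2 : ℝ) • v α)) := by
        ext y
        -- `e_ξ` takes the same value at both ends, because `ξ α` is an integer
        have h2 : expChar ξ (y + (1 / 2 : ℝ) • v α) = expChar ξ (y - (1 / 2 : ℝ) • v α) := by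
          have : y + (1 / 2 : ℝ) • v α = (y - (1 / 2 : ℝ) • v α) + v α := by module
          rw [this, expChar_add_apply, expChar_eq_one (hint α hα), mul_one]
        simp only [Pi.mul_apply, Pi.smul_apply, smul_eq_mul, ← h2]
        rw [expChar_add_apply]
        ring
      rw [e, boxAvg_smul, ih _ (Finset.erase_ssubset hα)
        (fun i hi => hint i (Finset.mem_of_mem_erase hi))
        (IsDM.centralDiff hq.smooth (hq.deriv_erase hα)), mul_zero]
    have hc0 : (2 * Real.pi * Complex.I * ξ (v α) : ℂ) ≠ 0 := by
      simp [Real.pi_ne_zero, hne]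
    have main (k : ℕ) : ∀ q, IsDM v A q → (dirDeriv (v α))^[k] q = 0 →
        boxAvg v A (expChar ξ * q) 0 = 0 := by
      induction k with
      | zero => intro q _ h0; rw [show q = 0 from h0, mul_zero]; simp [boxAvg]
      | succ k ihk =>
        intro q hq h0
        have := key q hq
        rw [ihk _ (hq.dirDeriv _) h0, add_zero] at this
        exact (mul_eq_zero.1 this).resolve_left hc0
    exact main _ q hq (hq.degLT.iterate_dirDeriv _)

end Character

/-! ### Distributions that are combinations of box splines -/

section Support

variable {I V : Type*} [Fintype I] [DecidableEq I] [NormedAddCommGroup V] [InnerProductSpace ℝ V]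
  [FiniteDimensional ℝ V] [MeasurableSpace V] [BorelSpace V]

/-- The complex-valued test functions supported in `W`. -/
abbrev TestFun (W : Set V) : Type _ :=
  {φ : V → ℂ // ContDiff ℝ ∞ φ ∧ HasCompactSupport φ ∧ tsupport φ ⊆ W}

lemma tsupport_dirDeriv_subset {φ : V → ℂ} (hφ : Differentiable ℝ φ) (v : V) :
    tsupport (dirDeriv v φ) ⊆ tsupport φ := by
  have : dirDeriv v φ = fun x => fderiv ℝ φ x v := funext fun x => dirDeriv_apply hφ v x
  rw [this]
  refine (closure_mono fun x hx => ?_).trans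
    ((isClosed_tsupport _).closure_subset_iff.2 (support_fderiv_subset ℝ (f := φ)))
  simp only [Function.mem_support] at hx ⊢
  exact fun h => hx (by rw [h]; rfl)

/-- The derivative of a test function. -/
def TestFun.dirDeriv {W : Set V} (v : V) (φ : TestFun W) : TestFun W :=
  ⟨BoxSpline.dirDeriv v φ.1, contDiff_dirDeriv φ.2.1 (by simp) v, by
    have h := tsupport_dirDeriv_subset (φ.2.1.differentiable (by simp)) v
    exact ⟨φ.2.2.1.of_isClosed_subset (isClosed_tsupport _) h, h.trans φ.2.2.2⟩⟩

lemma integral_mul_dirDeriv_eq_neg (μ : Measure V) [μ.IsAddHaarMeasure] {φ q : V → ℂ}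
    (hφ : ContDiff ℝ ∞ φ) (hc : HasCompactSupport φ) (hq : ContDiff ℝ ω q) (v : V) :
    ∫ x, φ x * dirDeriv v q x ∂μ = -∫ x, dirDeriv v φ x * q x ∂μ := by
  have hφd : Differentiable ℝ φ := hφ.differentiable (by simp)
  have hqd : Differentiable ℝ q := hq.differentiable (by simp)
  have hφ' := (contDiff_dirDeriv (m := 0) hφ (by simp) v).continuous
  have hq' := (contDiff_omega_dirDeriv hq v).continuous
  have hc' : HasCompactSupport (dirDeriv v φ) :=
    hc.of_isClosed_subset (isClosed_tsupport _) (tsupport_dirDeriv_subset hφd v)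
  have h1 := (hφ'.mul hq.continuous).integrable_of_hasCompactSupport (μ := μ) hc'.mul_right
  have h2 := (hφ.continuous.mul hq').integrable_of_hasCompactSupport (μ := μ) hc.mul_right
  have h3 := (hφ.continuous.mul hq.continuous).integrable_of_hasCompactSupport (μ := μ) hc.mul_right
  have e1 : dirDeriv v φ = fun x => fderiv ℝ φ x v := funext fun x => dirDeriv_apply hφd v x
  have e2 : dirDeriv v q = fun x => fderiv ℝ q x v := funext fun x => dirDeriv_apply hqd v x
  rw [e1] at h1 ⊢
  rw [e2] at h2 ⊢
  exact integral_mul_fderiv_eq_neg_fderiv_mul_of_integrable h1 h2 h3 (fun x _ => hφd x)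
    (fun x _ => hqd x)

/-- A combination of translates of the box spline of a non-spanning family is carried by a closed
null set, a finite union of proper affine subspaces. -/
lemma exists_null_carrier (μ : Measure V) [μ.IsAddHaarMeasure] {v : I → V} {A : Finset I}
    (hA : Submodule.span ℝ (v '' A) ≠ ⊤) {W : Set V} {F : TestFun W → ℂ}
    (hF : F ∈ Submodule.span ℂ (Set.range fun (w : V) (φ : TestFun W) => boxAvg v A φ.1 w)) :
    ∃ Z : Set V, IsClosed Z ∧ μ Z = 0 ∧ ∀ φ : TestFun W, (∀ z ∈ Z, φ.1 z = 0) → F φ = 0 := by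
  induction hF using Submodule.span_induction with
  | mem F hF =>
    obtain ⟨w, rfl⟩ := hF
    refine ⟨(fun x => x + -w) ⁻¹' (Submodule.span ℝ (v '' A) : Set V),
      (Submodule.closed_of_finiteDimensional _).preimage (by fun_prop), ?_, fun φ hφ => ?_⟩
    · rw [measure_preimage_add_right, Measure.addHaar_submodule μ _ hA]
    · have (t : I → ℝ) : φ.1 (w + ∑ i ∈ A, t i • v i) = 0 := by
        refine hφ _ ?_
        have : w + ∑ i ∈ A, t i • v i + -w = ∑ i ∈ A, t i • v i := by abel
        rw [Set.mem_preimage, this]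
        exact Submodule.sum_mem _ fun i hi => Submodule.smul_mem _ _
          (Submodule.subset_span ⟨i, hi, rfl⟩)
      simp [boxAvg, this]
  | zero => exact ⟨∅, isClosed_empty, by simp, fun _ _ => rfl⟩
  | add F G _ _ hF hG =>
    obtain ⟨Z, hZ, hZ0, h⟩ := hF
    obtain ⟨Z', hZ', hZ0', h'⟩ := hG
    refine ⟨Z ∪ Z', hZ.union hZ', by simp [hZ0, hZ0'], fun φ hφ => ?_⟩
    rw [Pi.add_apply, h φ fun z hz => hφ z (.inl hz), h' φ fun z hz => hφ z (.inr hz), add_zero]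
  | smul c F _ hF =>
    obtain ⟨Z, hZ, hZ0, h⟩ := hF
    exact ⟨Z, hZ, hZ0, fun φ hφ => by rw [Pi.smul_apply, h φ hφ, smul_zero]⟩

/-- An analytic function which on an open set is, as a distribution, a combination of translates of
the box spline of `A` lies in the Dahmen–Micchelli space of `A`: derivatives in directions from `A`
lead to combinations of translates of box splines of smaller subfamilies, and an analytic function
cannot be carried by a null set unless it is zero. -/
theorem isDM_of_mem_span (μ : Measure V) [μ.IsAddHaarMeasure] {v : I → V} {W : Set V}
    (hW : IsOpen W) (hne : W.Nonempty) (A : Finset I) {q : V → ℂ} (hq : ContDiff ℝ ω q)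
    (h : (fun φ : TestFun W => ∫ x, φ.1 x * q x ∂μ) ∈
      Submodule.span ℂ (Set.range fun (w : V) (φ : TestFun W) => boxAvg v A φ.1 w)) :
    IsDM v A q := by
  induction A using Finset.strongInductionOn generalizing q with
  | _ A ih =>
    refine ⟨hq, fun hA => ?_, fun α hα => ih _ (Finset.erase_ssubset hα)
      (contDiff_omega_dirDeriv hq _) ?_⟩
    · obtain ⟨Z, hZ, hZ0, hφ⟩ := exists_null_carrier μ hA h
      have hU : IsOpen (W \ Z) := hW.sdiff hZ
      have hUne : (W \ Z).Nonempty := by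
        refine nonempty_of_measure_ne_zero (μ := μ) ?_
        rw [measure_sdiff_null hZ0]
        exact (hW.measure_pos μ hne).ne'
      have hae : ∀ᵐ x ∂μ, x ∈ W \ Z → q x = 0 := by
        refine hU.ae_eq_zero_of_integral_contDiff_smul_eq_zero
          (hq.continuous.locallyIntegrable.locallyIntegrableOn _) fun g hg hgc hgs => ?_
        have hts : tsupport (fun x => (g x : ℂ)) ⊆ tsupport g := by
          refine closure_mono fun x hx => ?_
          simpa using hx
        have := hφ ⟨fun x => (g x : ℂ), Complex.ofRealCLM.contDiff.comp hg,
          hgc.of_isClosed_subset (isClosed_tsupport _) hts,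
          hts.trans (hgs.trans Set.sdiff_subset)⟩ fun z hz => by
            have : z ∉ tsupport g := fun h => (hgs h).2 hz
            simp [image_eq_zero_of_notMem_tsupport this]
        simpa using this
      refine eq_zero_of_eqOn_open hq hU hUne fun x hx => ?_
      by_contra hx0
      have hO : IsOpen ((W \ Z) ∩ {x | q x ≠ 0}) :=
        hU.inter (isOpen_ne_fun hq.continuous continuous_const)
      refine (hO.measure_pos μ ⟨x, hx, hx0⟩).ne' ?_
      refine measure_mono_null (fun y hy => ?_) hae
      exact fun h => hy.2 (h hy.1)
    · have e : (fun φ : TestFun W => ∫ x, φ.1 x * dirDeriv (v α) q x ∂μ) =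
          LinearMap.funLeft ℂ ℂ (TestFun.dirDeriv (v α))
            (-fun φ : TestFun W => ∫ x, φ.1 x * q x ∂μ) := by
        ext φ
        exact integral_mul_dirDeriv_eq_neg μ φ.2.1 φ.2.2.1 hq (v α)
      rw [e]
      refine Submodule.map_span_le _ _ _ |>.2 ?_ (Submodule.mem_map_of_mem (Submodule.neg_mem _ h))
      rintro _ ⟨w, rfl⟩
      have e2 : LinearMap.funLeft ℂ ℂ (TestFun.dirDeriv (v α))
          (fun φ : TestFun W => boxAvg v A φ.1 w) =
          (fun φ : TestFun W => boxAvg v (A.erase α) φ.1 (w + (1 / 2 : ℝ) • v α)) -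
          fun φ : TestFun W => boxAvg v (A.erase α) φ.1 (w + -((1 / 2 : ℝ) • v α)) := by
        ext φ
        have hc := φ.2.1.continuous
        have := boxAvg_dirDeriv (v := v) (φ.2.1.of_le (by exact_mod_cast le_top)) hα w
        rw [boxAvg_sub (by fun_prop) (by fun_prop)] at this
        refine this.trans ?_
        rw [Pi.sub_apply, ← boxAvg_comp_add, ← boxAvg_comp_add]
        simp only [sub_eq_add_neg]
      rw [e2]
      exact Submodule.sub_mem _ (Submodule.subset_span ⟨_, rfl⟩) (Submodule.subset_span ⟨_, rfl⟩)

end Support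

/-! ### The Bernoulli generating function -/

section PowerSeries

/-- The coefficient of `z ^ n` in the Taylor series of `(e^{z/2} - e^{-z/2}) / z`. -/
def sinhCoeff (n : ℕ) : ℂ := ((1 / 2) ^ (n + 1) - (-(1 / 2)) ^ (n + 1)) / ((n + 1).factorial : ℂ)

/-- The Taylor series of `z / (e^{z/2} - e^{-z/2})`, whose coefficients in even degree are the
`aCoeff m` and in odd degree vanish. -/
def aSeries : PowerSeries ℂ := PowerSeries.mk fun i => if Even i then aCoeff (i / 2) else 0

lemma aSeries_eq : aSeries = 2 * PowerSeries.rescale (1 / 2 : ℂ) (bernoulliPowerSeries ℂ) -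
    bernoulliPowerSeries ℂ := by
  ext n
  rw [show (2 : PowerSeries ℂ) = PowerSeries.C 2 from (map_ofNat _ 2).symm, map_sub, PowerSeries.coeff_C_mul,
    PowerSeries.coeff_rescale]
  simp only [aSeries, bernoulliPowerSeries, PowerSeries.coeff_mk, eq_ratCast, Rat.cast_div,
    Rat.cast_natCast]
  split_ifs with h
  · obtain ⟨m, rfl⟩ := h
    rw [aCoeff, show (m + m) / 2 = m by omega, ← two_mul, zpow_sub₀ two_ne_zero, zpow_one,
      show (2 * (m : ℤ)) = ((2 * m : ℕ) : ℤ) by push_cast; rfl, zpow_natCast, one_div, inv_pow]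
    ring
  · rw [Nat.not_even_iff_odd] at h
    by_cases h1 : n = 1
    · subst h1; norm_num
    · rw [bernoulli_eq_zero_of_odd h (by have := h.pos; omega)]; simp

lemma X_mul_mk_sinhCoeff : PowerSeries.X * PowerSeries.mk sinhCoeff =
    PowerSeries.rescale (1 / 2 : ℂ) (PowerSeries.exp ℂ) -
      PowerSeries.rescale (-(1 / 2) : ℂ) (PowerSeries.exp ℂ) := by
  ext n
  cases n with
  | zero =>
    rw [PowerSeries.coeff_zero_X_mul, map_sub, PowerSeries.coeff_rescale,
      PowerSeries.coeff_rescale]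
    simp
  | succ n =>
    rw [PowerSeries.coeff_succ_X_mul, PowerSeries.coeff_mk, map_sub, PowerSeries.coeff_rescale,
      PowerSeries.coeff_rescale, PowerSeries.coeff_exp, sinhCoeff]
    simp only [eq_ratCast, Rat.cast_div, Rat.cast_one, Rat.cast_natCast]
    ring

/-- The generating function identity of the Bernoulli numbers, with `e^z` written as the square
of `e^{z/2}`. -/
lemma aSeries_mul_mk_sinhCoeff : aSeries * PowerSeries.mk sinhCoeff = 1 := by
  have hB := bernoulliPowerSeries_mul_exp_sub_one ℂ
  have hB' := congrArg (PowerSeries.rescale (1 / 2 : ℂ)) hB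
  rw [map_mul, map_sub, map_one, PowerSeries.rescale_X] at hB'
  have h1 := PowerSeries.exp_mul_exp_eq_exp_add (1 / 2 : ℂ) (1 / 2)
  have h2 := PowerSeries.exp_mul_exp_eq_exp_add (1 / 2 : ℂ) (-(1 / 2))
  rw [add_halves, PowerSeries.rescale_one, RingHom.id_apply] at h1
  have h3 : PowerSeries.rescale (1 / 2 : ℂ) (PowerSeries.exp ℂ) *
      PowerSeries.rescale (-(1 / 2) : ℂ) (PowerSeries.exp ℂ) = 1 := by
    rw [h2, add_neg_cancel, PowerSeries.rescale_zero]
    simp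
  have hC : (2 : PowerSeries ℂ) * PowerSeries.C (1 / 2 : ℂ) = 1 := by
    rw [show (2 : PowerSeries ℂ) = PowerSeries.C 2 from (map_ofNat _ 2).symm, ← map_mul]; simp
  have hX : (PowerSeries.X : PowerSeries ℂ) ≠ 0 := PowerSeries.X_ne_zero
  refine mul_left_cancel₀ hX ?_
  rw [mul_left_comm, X_mul_mk_sinhCoeff, aSeries_eq]
  rw [← h1] at hB
  generalize PowerSeries.rescale (1 / 2 : ℂ) (bernoulliPowerSeries ℂ) = b' at *
  generalize PowerSeries.rescale (1 / 2 : ℂ) (PowerSeries.exp ℂ) = e at *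
  generalize PowerSeries.rescale (-(1 / 2) : ℂ) (PowerSeries.exp ℂ) = e' at *
  generalize bernoulliPowerSeries ℂ = b at *
  generalize (PowerSeries.C (1 / 2 : ℂ)) = c at *
  generalize (PowerSeries.X : PowerSeries ℂ) = X at *
  linear_combination (2 * e' * (e + 1)) * hB' - e' * hB + e' * (e + 1) * X * hC +
    (X - (2 * b' - b) * e) * h3

/-- The truncations of the two inverse series are inverse modulo `X ^ K`. -/
lemma X_pow_dvd_trunc_mul_sub_one (K : ℕ) :
    (Polynomial.X : Polynomial ℂ) ^ K ∣
      (∑ m ∈ Finset.range K, Polynomial.C (aCoeff m) * Polynomial.X ^ (2 * m)) *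
        (∑ n ∈ Finset.range K, Polynomial.C (sinhCoeff n) * Polynomial.X ^ n) - 1 := by
  rw [Polynomial.X_pow_dvd_iff]
  intro d hd
  have h := congrArg (PowerSeries.coeff d) aSeries_mul_mk_sinhCoeff
  rw [PowerSeries.coeff_mul] at h
  rw [Polynomial.coeff_sub, Polynomial.coeff_mul, sub_eq_zero, Polynomial.coeff_one]
  rw [PowerSeries.coeff_one] at h
  rw [← h]
  refine Finset.sum_congr rfl fun z hz => ?_
  rw [Finset.HasAntidiagonal.mem_antidiagonal] at hz
  congr 1
  · simp only [Polynomial.finsetSum_coeff, Polynomial.coeff_C_mul_X_pow, aSeries,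
      PowerSeries.coeff_mk]
    split_ifs with he
    · obtain ⟨m, hm⟩ := he
      rw [Finset.sum_eq_single (z.1 / 2)]
      · rw [if_pos (by omega)]
      · intro b _ hb; rw [if_neg (by omega)]
      · intro hb; exact absurd (Finset.mem_range.2 (by omega)) hb
    · refine Finset.sum_eq_zero fun m _ => if_neg ?_
      rintro hm
      exact he ⟨m, by omega⟩
  · simp only [Polynomial.finsetSum_coeff, Polynomial.coeff_C_mul_X_pow, PowerSeries.coeff_mk]
    rw [Finset.sum_ite_eq, if_pos (Finset.mem_range.2 (by omega))]

end PowerSeries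

/-! ### Averages over segments -/

section Taylor

variable {V : Type*} [NormedAddCommGroup V] [InnerProductSpace ℝ V]

/-- Taylor's formula on a line along which some iterated derivative vanishes. -/
lemma taylor_line {f : V → ℂ} (hf : ContDiff ℝ ω f) {v : V} {K : ℕ}
    (h : (dirDeriv v)^[K] f = 0) (x : V) (t : ℝ) :
    f (x + t • v) =
      ∑ n ∈ Finset.range K, ((t : ℂ) ^ n / (n.factorial : ℂ)) * (dirDeriv v)^[n] f x := by
  induction K generalizing f t with
  | zero => rw [show f = 0 from h]; simp
  | succ K ih =>
    have hd : Differentiable ℝ f := hf.differentiable (by simp)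
    have ih' := fun t => ih (contDiff_omega_dirDeriv hf v) h t
    have h1 (t : ℝ) (n : ℕ) : HasDerivAt
        (fun t : ℝ => ((t : ℂ) ^ (n + 1) / ((n + 1).factorial : ℂ)) * (dirDeriv v)^[n + 1] f x)
        (((t : ℂ) ^ n / (n.factorial : ℂ)) * (dirDeriv v)^[n] (dirDeriv v f) x) t := by
      have h2 := (((hasDerivAt_id t).ofReal_comp.pow (n + 1)).div_const
        ((n + 1).factorial : ℂ)).mul_const ((dirDeriv v)^[n + 1] f x)
      refine h2.congr_deriv ?_
      rw [Function.iterate_succ_apply, Nat.factorial_succ]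
      have : (n.factorial : ℂ) ≠ 0 := by exact_mod_cast n.factorial_ne_zero
      have : (n : ℂ) + 1 ≠ 0 := by exact_mod_cast n.succ_ne_zero
      push_cast
      simp only [id_eq]
      field_simp
    have hg (t : ℝ) : HasDerivAt (fun t : ℝ => f (x + t • v) - ∑ n ∈ Finset.range (K + 1),
        ((t : ℂ) ^ n / (n.factorial : ℂ)) * (dirDeriv v)^[n] f x) 0 t := by
      simp only [Finset.sum_range_succ']
      have := (hasDerivAt_line hd x v t).sub
        ((HasDerivAt.fun_sum fun n (_ : n ∈ Finset.range K) => h1 t n).add_const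
          (((t : ℂ) ^ 0 / ((0 : ℕ).factorial : ℂ)) * (dirDeriv v)^[0] f x))
      rw [ih' t, sub_self] at this
      exact this
    have := is_const_of_deriv_eq_zero (fun t => (hg t).differentiableAt)
      (fun t => (hg t).deriv) t 0
    rw [← sub_eq_zero, this, Finset.sum_range_succ']
    simp

lemma integral_segment_eq_sum {f : V → ℂ} (hf : ContDiff ℝ ω f) {v : V} {K : ℕ}
    (h : (dirDeriv v)^[K] f = 0) (x : V) :
    ∫ s in Set.Icc (-(1 / 2) : ℝ) (1 / 2), f (x + s • v) =
      ∑ n ∈ Finset.range K, sinhCoeff n * (dirDeriv v)^[n] f x := by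
  simp only [taylor_line hf h x]
  rw [integral_Icc_eq_integral_Ioc, ← intervalIntegral.integral_of_le (by norm_num),
    intervalIntegral.integral_finsetSum
      fun n _ => by apply Continuous.intervalIntegrable; fun_prop]
  refine Finset.sum_congr rfl fun n _ => ?_
  rw [intervalIntegral.integral_mul_const, intervalIntegral.integral_div]
  congr 1
  have : ∫ t in (-(1 / 2) : ℝ)..(1 / 2), (t : ℂ) ^ n =
      (((1 / 2 : ℝ) ^ (n + 1) - (-(1 / 2)) ^ (n + 1)) / (n + 1) : ℝ) := by
    rw [← integral_pow, ← intervalIntegral.integral_ofReal]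
    simp
  rw [this, sinhCoeff, Nat.factorial_succ]
  push_cast
  rw [div_div]

end Taylor

/-! ### Constant coefficient differential operators -/

section Operators

variable (V : Type*) [NormedAddCommGroup V] [InnerProductSpace ℝ V]

/-- The space of complex-valued real analytic functions on `V`. -/
def analyticFun : Submodule ℂ (V → ℂ) where
  carrier := {f | ContDiff ℝ ω f}
  add_mem' {f g} (hf : ContDiff ℝ ω f) (hg : ContDiff ℝ ω g) := hf.add hg
  zero_mem' := (contDiff_const : ContDiff ℝ ω fun _ : V => (0 : ℂ))
  smul_mem' c f (hf : ContDiff ℝ ω f) := (contDiff_const (c := c)).smul hf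

variable {V}

lemma analyticFun_contDiff (f : analyticFun V) : ContDiff ℝ ω f.1 := f.2

lemma analyticFun_differentiable (f : analyticFun V) : Differentiable ℝ f.1 :=
  (analyticFun_contDiff f).differentiable (by simp)

/-- The directional derivative as an endomorphism of the space of analytic functions. -/
def derivEnd (v : V) : Module.End ℂ (analyticFun V) where
  toFun f := ⟨dirDeriv v f.1, contDiff_omega_dirDeriv f.2 v⟩
  map_add' f g := Subtype.ext (dirDeriv_add (analyticFun_differentiable f) (analyticFun_differentiable g) v)
  map_smul' c f := Subtype.ext (dirDeriv_smul (analyticFun_differentiable f) c v)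

lemma derivEnd_pow_apply (v : V) (n : ℕ) (f : analyticFun V) :
    ((derivEnd v ^ n) f : V → ℂ) = (dirDeriv v)^[n] f := by
  induction n generalizing f with
  | zero => rfl
  | succ n ih => rw [pow_succ, Module.End.mul_apply, ih, Function.iterate_succ_apply]; rfl

variable {I : Type*}

open scoped IsMulCommutative in
/-- The constant coefficient differential operators generated by the `∂_{v i}`, as the action of a
polynomial algebra; it exists because directional derivatives of analytic functions commute. -/
def diffOp (v : I → V) : MvPolynomial I ℂ →ₐ[ℂ] Module.End ℂ (analyticFun V) :=
  haveI : IsMulCommutative (Algebra.adjoin ℂ (Set.range fun i => derivEnd (v i))) :=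
    Algebra.isMulCommutative_adjoin ℂ (by
      rintro _ ⟨i, rfl⟩ _ ⟨j, rfl⟩
      ext1 f
      exact Subtype.ext (dirDeriv_comm_omega (analyticFun_contDiff f) (v i) (v j)))
  (Algebra.adjoin ℂ (Set.range fun i => derivEnd (v i))).val.comp
    (MvPolynomial.aeval fun i => ⟨derivEnd (v i), Algebra.subset_adjoin ⟨i, rfl⟩⟩)

@[simp] lemma diffOp_X (v : I → V) (i : I) : diffOp v (MvPolynomial.X i) = derivEnd (v i) := by
  simp [diffOp]

lemma diffOp_X_pow_apply (v : I → V) (i : I) (n : ℕ) (f : analyticFun V) :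
    (diffOp v (MvPolynomial.X i ^ n) f : V → ℂ) = (dirDeriv (v i))^[n] f := by
  rw [map_pow, diffOp_X, derivEnd_pow_apply]

lemma diffOp_mul_apply (v : I → V) (P Q : MvPolynomial I ℂ) (f : analyticFun V) :
    diffOp v (P * Q) f = diffOp v P (diffOp v Q f) := by rw [map_mul]; rfl

lemma DegLT.deriv {k : ℕ} {f : V → ℂ} (h : DegLT k f) (v : V) : DegLT k (dirDeriv v f) :=
  h.succ v

lemma DegLT.diffOp {k : ℕ} {f : analyticFun V} (h : DegLT k f.1) (v : I → V)
    (P : MvPolynomial I ℂ) : DegLT k (BoxSpline.diffOp v P f).1 := by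
  induction P using MvPolynomial.induction_on generalizing f with
  | C c =>
    have : BoxSpline.diffOp v (MvPolynomial.C c) f = c • f := by
      have := (BoxSpline.diffOp v).commutes c
      rw [MvPolynomial.algebraMap_eq] at this
      rw [this]; rfl
    rw [this]
    exact h.smul f.2 c
  | add P Q hP hQ =>
    rw [map_add]
    exact (hP h).add (Subtype.prop _) (Subtype.prop _) (hQ h)
  | mul_X P i hP =>
    rw [diffOp_mul_apply, diffOp_X]
    exact hP (h.deriv (v i))

variable [Fintype I] [DecidableEq I]

/-- The averaging operator along the box spline of `A` is the operator
`∏ α ∈ A, (e^{∂_α/2} - e^{-∂_α/2}) / ∂_α`. -/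
lemma boxAvg_eq_diffOp (v : I → V) {K : ℕ} (A : Finset I) (f : analyticFun V)
    (hf : DegLT K f.1) :
    boxAvg v A f.1 = diffOp v (∏ i ∈ A, ∑ n ∈ Finset.range K,
      MvPolynomial.C (sinhCoeff n) * MvPolynomial.X i ^ n) f := by
  induction A using Finset.induction_on generalizing f with
  | empty => ext x; simp [boxAvg]
  | insert i A hi ih =>
    ext x
    have e : (fun y => ∫ s in Set.Icc (-(1 / 2) : ℝ) (1 / 2), f.1 (y + s • v i)) =
        diffOp v (∑ n ∈ Finset.range K, MvPolynomial.C (sinhCoeff n) * MvPolynomial.X i ^ n) f := by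
      ext y
      rw [integral_segment_eq_sum f.2 (hf.iterate_dirDeriv _) y, map_sum]
      simp only [LinearMap.coe_sum, Finset.sum_apply, Submodule.coe_sum, MvPolynomial.C_mul',
        map_smul, LinearMap.smul_apply, Submodule.coe_smul, Pi.smul_apply, diffOp_X_pow_apply,
        smul_eq_mul]
    rw [boxAvg_eq_erase (analyticFun_contDiff f).continuous (Finset.mem_insert_self i A), e, Finset.erase_insert hi,
      ih _ (hf.diffOp v _), Finset.prod_insert hi, mul_comm, diffOp_mul_apply]

/-- The product of the truncated operators `∂_α / (e^{∂_α/2} - e^{-∂_α/2})` inverts the averaging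
operator on polynomials of bounded degree. -/
lemma diffOp_aCoeff_boxAvg (v : I → V) {K : ℕ} (A : Finset I) (f : analyticFun V)
    (hf : DegLT K f.1) :
    diffOp v ((∏ i ∈ A, ∑ m ∈ Finset.range K,
        MvPolynomial.C (aCoeff m) * MvPolynomial.X i ^ (2 * m)) *
      ∏ i ∈ A, ∑ n ∈ Finset.range K,
        MvPolynomial.C (sinhCoeff n) * MvPolynomial.X i ^ n) f = f := by
  rw [← Finset.prod_mul_distrib]
  induction A using Finset.induction_on with
  | empty => simp
  | insert i A hi ih =>
    rw [Finset.prod_insert hi, mul_comm, diffOp_mul_apply]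
    obtain ⟨r, hr⟩ := X_pow_dvd_trunc_mul_sub_one K
    have hr' := congrArg (Polynomial.aeval (MvPolynomial.X i : MvPolynomial I ℂ))
      (sub_eq_iff_eq_add.1 hr)
    simp only [map_add, map_mul, map_sum, map_one, map_pow, Polynomial.aeval_C,
      Polynomial.aeval_X, MvPolynomial.algebraMap_eq] at hr'
    rw [hr']
    have : diffOp v (MvPolynomial.X i ^ K *
        Polynomial.aeval (MvPolynomial.X i : MvPolynomial I ℂ) r + 1) f = f := by
      rw [mul_comm, map_add, LinearMap.add_apply, diffOp_mul_apply]
      have h0 : diffOp v (MvPolynomial.X i ^ K) f = 0 :=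
        Subtype.ext ((diffOp_X_pow_apply v i K f).trans (hf.iterate_dirDeriv _))
      rw [h0]; simp
    rw [this, ih]

end Operators

/-! ### The operator `Â` inverts averaging -/

section Ahat

variable {ι V N : Type*} [Finite ι] [NormedAddCommGroup V] [InnerProductSpace ℝ V]
  [AddCommGroup N] [Module ℝ N] {P : RootPairing ι ℝ V N} (Δ : P.Base)

/-- The positive roots as a family of vectors. -/
def posRoots (α : PosRoot Δ) : V := P.root α

lemma multiDeriv_eq_diffOp (n : PosRoot Δ → ℕ) (f : analyticFun V) :
    multiDeriv Δ n f.1 = diffOp (posRoots Δ) (∏ α, MvPolynomial.X α ^ (2 * n α)) f := by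
  have (l : List (PosRoot Δ)) :
      l.foldr (fun (α : PosRoot Δ) g => (dirDeriv (P.root α))^[2 * n α] g) f.1 =
        diffOp (posRoots Δ) ((l.map fun α => MvPolynomial.X α ^ (2 * n α)).prod) f := by
    induction l with
    | nil => simp
    | cons α l ih =>
      rw [List.foldr_cons, ih, List.map_cons, List.prod_cons, diffOp_mul_apply, diffOp_X_pow_apply]
      rfl
  rw [multiDeriv, this, Finset.prod_map_toList]

lemma ahatTerm_eq_zero {K : ℕ} (f : analyticFun V) (hf : DegLT K f.1) {n : PosRoot Δ → ℕ}
    (hn : ∃ α, K ≤ n α) : ahatTerm Δ n f.1 = 0 := by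
  classical
  obtain ⟨α, hα⟩ := hn
  have : diffOp (posRoots Δ) (∏ α, MvPolynomial.X α ^ (2 * n α)) f = 0 := by
    rw [← Finset.prod_erase_mul _ _ (Finset.mem_univ α),
      show 2 * n α = (2 * n α - K) + K by omega, pow_add, ← mul_assoc, diffOp_mul_apply]
    have h0 : diffOp (posRoots Δ) (MvPolynomial.X α ^ K) f = 0 :=
      Subtype.ext ((diffOp_X_pow_apply _ α K f).trans (hf.iterate_dirDeriv _))
    rw [h0, map_zero]
  ext x
  rw [ahatTerm, multiDeriv_eq_diffOp, this]
  simp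

lemma finite_ahatTerm_ne_zero {K : ℕ} (f : analyticFun V) (hf : DegLT K f.1) :
    {n : PosRoot Δ → ℕ | ahatTerm Δ n f.1 ≠ 0}.Finite := by
  classical
  refine (Fintype.piFinset fun _ : PosRoot Δ => Finset.range K).finite_toSet.subset fun n hn => ?_
  simp only [Finset.mem_coe, Fintype.mem_piFinset, Finset.mem_range]
  by_contra! h
  exact hn (ahatTerm_eq_zero Δ f hf h)

lemma ahat_eq_diffOp {K : ℕ} (f : analyticFun V) (hf : DegLT K f.1) :
    ahat Δ f.1 = diffOp (posRoots Δ) (∏ α, ∑ m ∈ Finset.range K,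
      MvPolynomial.C (aCoeff m) * MvPolynomial.X α ^ (2 * m)) f := by
  classical
  ext x
  rw [ahat, tsum_eq_sum (s := Fintype.piFinset fun _ : PosRoot Δ => Finset.range K),
    Finset.prod_univ_sum, map_sum, LinearMap.sum_apply, Submodule.coe_sum, Finset.sum_apply]
  · refine Finset.sum_congr rfl fun n _ => ?_
    rw [Finset.prod_mul_distrib, ← map_prod, MvPolynomial.C_mul', map_smul, ahatTerm,
      multiDeriv_eq_diffOp]
    rfl
  · intro n hn
    simp only [Fintype.mem_piFinset, Finset.mem_range, not_forall, not_lt] at hn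
    rw [ahatTerm_eq_zero Δ f hf hn]; rfl

/-- The operator `Â` inverts averaging against the box spline, on polynomials. -/
theorem ahat_boxAvg {K : ℕ} {f : V → ℂ} (hs : ContDiff ℝ ω f) (hf : DegLT K f) :
    ahat Δ (boxAvg (posRoots Δ) Finset.univ f) = f := by
  classical
  have h := boxAvg_eq_diffOp (posRoots Δ) Finset.univ ⟨f, hs⟩ hf
  have hd := DegLT.diffOp (f := ⟨f, hs⟩) hf (posRoots Δ) (∏ i, ∑ n ∈ Finset.range K,
      MvPolynomial.C (sinhCoeff n) * MvPolynomial.X i ^ n)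
  rw [h, ahat_eq_diffOp Δ _ hd, ← diffOp_mul_apply, diffOp_aCoeff_boxAvg _ _ _ hf]

end Ahat

/-! ### The density of the box spline -/

section Density

variable {I S V : Type*} [Fintype I] [DecidableEq I] [Fintype S]
  [NormedAddCommGroup V] [InnerProductSpace ℝ V]

/-- The closed parallelepiped spanned by a basis, centered at the origin. -/
def centeredBox (b : Module.Basis S ℝ V) : Set V :=
  {x | ∀ s, b.repr x s ∈ Set.Icc (-(1 / 2) : ℝ) (1 / 2)}

lemma continuous_repr [FiniteDimensional ℝ V] (b : Module.Basis S ℝ V) (s : S) :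
    Continuous fun x => b.repr x s :=
  (b.coord s).continuous_of_finiteDimensional

lemma isClosed_centeredBox [FiniteDimensional ℝ V] (b : Module.Basis S ℝ V) :
    IsClosed (centeredBox b) := by
  simp only [centeredBox, Set.ofPred_forall]
  exact isClosed_iInter fun s => isClosed_Icc.preimage (continuous_repr b s)

lemma isCompact_centeredBox [FiniteDimensional ℝ V] (b : Module.Basis S ℝ V) :
    IsCompact (centeredBox b) := by
  have : centeredBox b = b.equivFunL.toHomeomorph ⁻¹'
      (Set.univ.pi fun _ => Set.Icc (-(1 / 2) : ℝ) (1 / 2)) := by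
    ext x
    exact ⟨fun h s _ => h s, fun h s => h s trivial⟩
  rw [this, Homeomorph.isCompact_preimage]
  exact isCompact_univ_pi fun _ => isCompact_Icc

lemma notMem_frontier_centeredBox [FiniteDimensional ℝ V] (b : Module.Basis S ℝ V) {x : V}
    (hx : ∀ s, |b.repr x s| ≠ 1 / 2) : x ∉ frontier (centeredBox b) := by
  rw [(isClosed_centeredBox b).frontier_eq]
  rintro ⟨h1, h2⟩
  refine h2 (mem_interior.2 ⟨⋂ s, (fun x => b.repr x s) ⁻¹' Set.Ioo (-(1 / 2)) (1 / 2), ?_,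
    isOpen_iInter_of_finite fun s => isOpen_Ioo.preimage (continuous_repr b s), ?_⟩)
  · intro y hy s
    rw [Set.mem_iInter] at hy
    exact Set.Ioo_subset_Icc_self (hy s)
  · rw [Set.mem_iInter]
    intro s
    exact abs_lt.1 (lt_of_le_of_ne (abs_le.2 (h1 s)) (hx s))

variable [FiniteDimensional ℝ V] [MeasurableSpace V] [BorelSpace V]

lemma measurePreserving_equivFunL_symm (b : Module.Basis S ℝ V) :
    MeasurePreserving b.equivFunL.symm volume b.addHaar := by
  refine ⟨b.equivFunL.symm.continuous.measurable, ?_⟩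
  classical
  rw [← addHaarMeasure_eq_volume_pi, ← Module.Basis.parallelepiped_basisFun,
    ← Module.Basis.addHaar_def, Module.Basis.map_addHaar]
  congr 1
  ext s
  refine (b.equivFun_symm_apply _).trans ?_
  simp [Pi.single_apply, Pi.basisFun_apply]

lemma iIndepFun_cube : ProbabilityTheory.iIndepFun (fun (i : I) (t : I → ℝ) => t i) (cube I) := by
  have := isProbabilityMeasure_restrict_Icc
  exact ProbabilityTheory.iIndepFun_pi (X := fun _ => id) fun _ => aemeasurable_id

lemma measurePreserving_cube_comp {e : S → I} (he : Function.Injective e) :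
    MeasurePreserving (fun (t : I → ℝ) s => t (e s)) (cube I) (cube S) := by
  have := isProbabilityMeasure_restrict_Icc
  have hm : Measurable fun (t : I → ℝ) s => t (e s) := by fun_prop
  refine ⟨hm, ?_⟩
  have h := iIndepFun_cube.precomp he
  rw [ProbabilityTheory.iIndepFun_iff_map_fun_eq_pi_map
    (fun s => (measurable_pi_apply (e s)).aemeasurable)] at h
  rw [h]
  unfold cube
  congr 1
  ext1 s
  exact (measurePreserving_eval _ (e s)).map_eq

/-- The box spline of a basis is Lebesgue measure on the centered parallelepiped. -/
lemma map_cube_basis (b : Module.Basis S ℝ V) {e : S → I} (he : Function.Injective e) :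
    (cube I).map (fun t => ∑ s, t (e s) • b s) = b.addHaar.restrict (centeredBox b) := by
  have h := (measurePreserving_equivFunL_symm b).restrict_preimage
    (isClosed_centeredBox b).measurableSet
  have hpre : b.equivFunL.symm ⁻¹' centeredBox b =
      Set.univ.pi fun _ : S => Set.Icc (-(1 / 2) : ℝ) (1 / 2) := by
    ext u
    have (s : S) : b.repr (b.equivFunL.symm u) s = u s := by
      have := congrFun (b.equivFunL.apply_symm_apply u) s
      simpa using this
    simp only [centeredBox, Set.mem_preimage, Set.mem_ofPred_eq, this, Set.mem_pi, Set.mem_univ,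
      true_imp_iff]
  rw [hpre, ← cube_eq_restrict] at h
  rw [← (h.comp (measurePreserving_cube_comp he)).map_eq]
  congr 1
  ext t
  exact (b.equivFun_symm_apply _).symm

/-- An explicit version of the density of the box spline of the family `v`, of which the basis `b`
is the subfamily indexed by `e`: at `x`, it is the volume of the set of those `t` in the cube for
which `x - ∑ i, t i • v i`, the sum over the members outside the basis, lies in the parallelepiped
of the basis. -/
def boxDensity (b : Module.Basis S ℝ V) (v : I → V) (e : S → I) (x : V) : ℝ :=
  (cube I).real {t | x - ∑ i ∈ (Finset.univ.image e)ᶜ, t i • v i ∈ centeredBox b}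

variable {b : Module.Basis S ℝ V} {v : I → V} {e : S → I}

lemma measurableSet_boxDensity :
    MeasurableSet {z : V × (I → ℝ) | z.1 - ∑ i ∈ (Finset.univ.image e)ᶜ, z.2 i • v i ∈
      centeredBox b} :=
  (isClosed_centeredBox b).measurableSet.preimage (by fun_prop)

lemma measurable_boxDensity : Measurable (boxDensity b v e) :=
  (measurable_measure_prodMk_left (measurableSet_boxDensity (b := b) (v := v) (e := e))).ennreal_toReal

lemma boxDensity_nonneg (x : V) : 0 ≤ boxDensity b v e x := measureReal_nonneg

lemma boxDensity_le_one (x : V) : boxDensity b v e x ≤ 1 := measureReal_le_one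

lemma map_cube_eq_withDensity (he : Function.Injective e) (hv : ∀ s, v (e s) = b s) :
    (cube I).map (fun t => ∑ i, t i • v i) =
      b.addHaar.withDensity fun x => ENNReal.ofReal (boxDensity b v e x) := by
  set Y : (I → ℝ) → V := fun t => ∑ i ∈ (Finset.univ.image e)ᶜ, t i • v i with hY
  have hYm : Measurable Y := by fun_prop
  have hXm : Measurable fun t : I → ℝ => ∑ s, t (e s) • b s := by fun_prop
  have hsum : (fun t : I → ℝ => ∑ i, t i • v i) = (fun t => ∑ s, t (e s) • b s) + Y := by
    ext t
    rw [← Finset.sum_add_sum_compl (Finset.univ.image e), Finset.sum_image he.injOn]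
    simp [hv, hY]
  have hind : ProbabilityTheory.IndepFun (fun t : I → ℝ => ∑ s, t (e s) • b s) Y (cube I) := by
    have h := iIndepFun_cube.indepFun_finset (Finset.univ.image e) (Finset.univ.image e)ᶜ
      disjoint_compl_right (fun i => measurable_pi_apply i)
    have h2 := h.comp (φ := fun t => ∑ i, t i • v i.1) (ψ := fun t => ∑ i, t i • v i.1)
      (by fun_prop) (by fun_prop)
    refine h2.congr (.of_forall fun t => ?_) (.of_forall fun t => ?_)
    · simp only [Function.comp]
      rw [Finset.sum_coe_sort (Finset.univ.image e) (fun i => t i • v i),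
        Finset.sum_image he.injOn]
      simp [hv]
    · simp only [Function.comp]
      exact Finset.sum_coe_sort (Finset.univ.image e)ᶜ (fun i => t i • v i)
  have : IsProbabilityMeasure ((cube I).map Y) :=
    Measure.isProbabilityMeasure_map hYm.aemeasurable
  rw [hsum, hind.map_add_eq_map_conv_map hXm hYm, map_cube_basis b he]
  refine Measure.ext_of_lintegral _ fun f hf => ?_
  have hβ (x : V) : ENNReal.ofReal (boxDensity b v e x) =
      ∫⁻ t, (centeredBox b).indicator 1 (x - Y t) ∂cube I := by
    rw [boxDensity, ofReal_measureReal, ← lintegral_indicator_one]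
    · rfl
    · exact (isClosed_centeredBox b).measurableSet.preimage (by fun_prop)
  have hind1 : Measurable ((centeredBox b).indicator (1 : V → ENNReal)) :=
    measurable_one.indicator (isClosed_centeredBox b).measurableSet
  rw [Measure.lintegral_conv hf, lintegral_withDensity_eq_lintegral_mul _ (by
      exact measurable_boxDensity.ennreal_ofReal) hf]
  simp only [Pi.mul_apply, hβ]
  calc ∫⁻ x in centeredBox b, ∫⁻ y, f (x + y) ∂(cube I).map Y ∂b.addHaar
      = ∫⁻ x in centeredBox b, ∫⁻ t, f (x + Y t) ∂cube I ∂b.addHaar := by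
        refine lintegral_congr fun x => ?_
        rw [lintegral_map (by fun_prop) hYm]
    _ = ∫⁻ t, ∫⁻ x in centeredBox b, f (x + Y t) ∂b.addHaar ∂cube I := by
        rw [lintegral_lintegral_swap]
        exact (hf.comp (by fun_prop)).aemeasurable
    _ = ∫⁻ t, ∫⁻ x, (centeredBox b).indicator 1 (x - Y t) * f x ∂b.addHaar ∂cube I := by
        refine lintegral_congr fun t => ?_
        rw [← lintegral_indicator (isClosed_centeredBox b).measurableSet,
          ← lintegral_add_right_eq_self (fun x => (centeredBox b).indicator 1 (x - Y t) * f x)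
            (Y t)]
        refine lintegral_congr fun x => ?_
        rw [add_sub_cancel_right]
        by_cases h : x ∈ centeredBox b <;> simp [h]
    _ = ∫⁻ x, ∫⁻ t, (centeredBox b).indicator 1 (x - Y t) * f x ∂cube I ∂b.addHaar := by
        rw [lintegral_lintegral_swap]
        exact ((hind1.comp (by fun_prop)).mul (hf.comp (by fun_prop))).aemeasurable
    _ = _ := by
        refine lintegral_congr fun x => ?_
        exact lintegral_mul_const _ (hind1.comp (f := fun t => x - Y t) (by fun_prop))

/-- A hyperplane section of the cube is a null set. -/
lemma ae_cube_sum_ne (c : I → ℝ) (k : ℝ) (h : (∃ i, c i ≠ 0) ∨ k ≠ 0) :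
    ∀ᵐ t ∂cube I, ∑ i, t i * c i ≠ k := by
  by_cases hc : ∃ i, c i ≠ 0
  · obtain ⟨i, hi⟩ := hc
    let L : (I → ℝ) →ₗ[ℝ] ℝ := ∑ i, c i • LinearMap.proj i
    have hL (t : I → ℝ) : L t = ∑ i, t i * c i := by simp [L, mul_comm]
    have hsurj : Function.Surjective L := by
      refine LinearMap.surjective_of_ne_zero fun h0 => hi ?_
      have := hL (Pi.single i 1)
      rw [h0] at this
      simpa [Pi.single_apply] using this.symm
    have := (ae_comp_linearMap_mem_iff L (volume : Measure (I → ℝ)) (volume : Measure ℝ) hsurj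
      (s := {k}ᶜ) (measurableSet_singleton k).compl).2 (by
        rw [ae_iff]; simp)
    rw [cube_eq_restrict]
    filter_upwards [ae_restrict_of_ae this] with t ht
    rw [← hL]
    exact ht
  · have hk := h.resolve_left hc
    push Not at hc
    exact .of_forall fun t => by simp [hc, hk.symm]

/-- The explicit density is continuous away from the hyperplanes on which a coordinate takes the
value `±1/2`; by dominated convergence only those `t` matter for which `x` lies on the boundary of
the translated parallelepiped, and they form a null set. -/
lemma continuousAt_boxDensity {x : V} (hx : ∀ s, |b.repr x s| ≠ 1 / 2) :
    ContinuousAt (boxDensity b v e) x := by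
  have hβ : boxDensity b v e = fun x => ∫ t, (centeredBox b).indicator (fun _ => (1 : ℝ))
      (x - ∑ i ∈ (Finset.univ.image e)ᶜ, t i • v i) ∂cube I := by
    ext y
    rw [boxDensity, ← integral_indicator_one]
    · rfl
    · exact (isClosed_centeredBox b).measurableSet.preimage (by fun_prop)
  have hm : Measurable ((centeredBox b).indicator (fun _ => (1 : ℝ))) :=
    measurable_const.indicator (isClosed_centeredBox b).measurableSet
  have hae : ∀ᵐ t ∂cube I, ∀ s,
      |b.repr (x - ∑ i ∈ (Finset.univ.image e)ᶜ, t i • v i) s| ≠ 1 / 2 := by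
    rw [ae_all_iff]
    intro s
    have key (k : ℝ) (hk : |k| = 1 / 2) : ∀ᵐ t ∂cube I,
        ∑ i, t i * (if i ∈ (Finset.univ.image e)ᶜ then b.repr (v i) s else 0) ≠
          b.repr x s - k := by
      refine ae_cube_sum_ne _ _ (.inr fun h0 => hx s ?_)
      rw [sub_eq_zero.1 h0, hk]
    filter_upwards [key (1 / 2) (by norm_num), key (-(1 / 2)) (by norm_num)] with t h1 h2 h
    simp only [map_sub, map_sum, map_smul, Finsupp.coe_sub, Pi.sub_apply, Finsupp.coe_finsetSum,
      Finset.sum_apply, Finsupp.coe_smul, Pi.smul_apply, smul_eq_mul] at h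
    simp only [mul_ite, mul_zero, Finset.sum_ite_mem, Finset.univ_inter] at h1 h2
    rcases (abs_eq (by norm_num)).1 h with h | h
    · exact h1 (by linarith)
    · exact h2 (by linarith)
  rw [hβ]
  refine tendsto_integral_filter_of_dominated_convergence (fun _ => 1)
    (.of_forall fun y => (hm.comp (by fun_prop)).aestronglyMeasurable)
    (.of_forall fun y => .of_forall fun t => ?_) (integrable_const _) ?_
  · exact (norm_indicator_le_norm_self _ _).trans (by simp)
  · filter_upwards [hae] with t ht
    have h2 : ContinuousAt ((centeredBox b).indicator fun _ => (1 : ℝ))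
        (x - ∑ i ∈ (Finset.univ.image e)ᶜ, t i • v i) :=
      (continuous_const.continuousOn).continuousAt_indicator (notMem_frontier_centeredBox b ht)
    exact ContinuousAt.comp (f := fun y => y - ∑ i ∈ (Finset.univ.image e)ᶜ, t i • v i)
      (x := x) h2 (by fun_prop)

lemma ae_abs_repr_ne (b : Module.Basis S ℝ V) : ∀ᵐ x ∂b.addHaar, ∀ s, |b.repr x s| ≠ 1 / 2 := by
  rw [ae_all_iff]
  intro s
  have hsurj : Function.Surjective (b.coord s) :=
    LinearMap.surjective_of_ne_zero fun h0 => by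
      have : b.coord s (b s) = 0 := by rw [h0]; rfl
      simp at this
  have := (ae_comp_linearMap_mem_iff (b.coord s) b.addHaar (volume : Measure ℝ) hsurj
    (s := {1 / 2, -(1 / 2)}ᶜ) (by measurability)).2 (by
      rw [ae_iff]
      have : {a : ℝ | a ∉ ({1 / 2, -(1 / 2)}ᶜ : Set ℝ)} = {1 / 2, -(1 / 2)} := by
        ext; simp only [Set.mem_ofPred_eq, Set.mem_compl_iff, not_not]
      rw [this]
      exact (Set.toFinite _).measure_zero _)
  filter_upwards [this] with x hx h
  exact hx ((abs_eq (by norm_num)).1 h)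

lemma exists_norm_le_of_boxDensity_ne_zero (b : Module.Basis S ℝ V) (v : I → V) (e : S → I) :
    ∃ R : ℝ, ∀ x, boxDensity b v e x ≠ 0 → ‖x‖ ≤ R := by
  obtain ⟨R, hR⟩ := (isCompact_centeredBox b).isBounded.exists_norm_le
  refine ⟨R + ∑ i, ‖v i‖, fun x hx => ?_⟩
  have h0 : ∃ t : I → ℝ, (x - ∑ i ∈ (Finset.univ.image e)ᶜ, t i • v i ∈ centeredBox b) ∧
      ∀ i, t i ∈ Set.Icc (-(1 / 2) : ℝ) (1 / 2) := by
    by_contra! h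
    refine hx ?_
    rw [boxDensity, measureReal_eq_zero_iff, measure_eq_zero_iff_ae_notMem]
    filter_upwards [ae_mem_cube] with t ht ht2
    obtain ⟨i, hi⟩ := h t ht2
    exact hi (ht i)
  obtain ⟨t, h1, h2⟩ := h0
  have h3 : ‖∑ i ∈ (Finset.univ.image e)ᶜ, t i • v i‖ ≤ ∑ i, ‖v i‖ := by
    refine (norm_sum_le _ _).trans ((Finset.sum_le_sum fun i _ => ?_).trans
      (Finset.sum_le_sum_of_subset_of_nonneg (Finset.subset_univ _) fun _ _ _ => norm_nonneg _))
    rw [norm_smul]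
    have : ‖t i‖ ≤ 1 := (abs_le.2 (h2 i)).trans (by norm_num)
    nlinarith [norm_nonneg (v i)]
  calc ‖x‖ = ‖(x - ∑ i ∈ (Finset.univ.image e)ᶜ, t i • v i) +
        ∑ i ∈ (Finset.univ.image e)ᶜ, t i • v i‖ := by rw [sub_add_cancel]
    _ ≤ _ := (norm_add_le _ _).trans (add_le_add (hR _ h1) h3)

lemma boxAvg_univ_eq_integral (he : Function.Injective e) (hv : ∀ s, v (e s) = b s) {f : V → ℂ}
    (hf : Continuous f) (x : V) :
    boxAvg v Finset.univ f x = ∫ y, (boxDensity b v e y : ℂ) * f (x + y) ∂b.addHaar := by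
  have h := integral_map (μ := cube I) (φ := fun t => ∑ i, t i • v i)
    (f := fun y => f (x + y)) (Continuous.measurable (by fun_prop)).aemeasurable (by fun_prop)
  rw [boxAvg, ← h, map_cube_eq_withDensity he hv]
  simp only [ENNReal.ofReal]
  rw [integral_withDensity_eq_integral_smul measurable_boxDensity.real_toNNReal]
  refine integral_congr_ae (.of_forall fun y => ?_)
  simp only [NNReal.smul_def, Real.coe_toNNReal _ (boxDensity_nonneg _), Complex.real_smul]

/-- Where the explicit density is continuous, it is the limit of the mean densities on balls. -/
lemma tendsto_mean_boxDensity (he : Function.Injective e) (hv : ∀ s, v (e s) = b s) {x : V}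
    (hx : ∀ s, |b.repr x s| ≠ 1 / 2) :
    Tendsto (fun r : ℝ => ((cube I).map fun t => ∑ i, t i • v i).real (Metric.closedBall x r) /
      b.addHaar.real (Metric.closedBall x r)) (𝓝[>] 0) (𝓝 (boxDensity b v e x)) := by
  have hpos : ∀ᶠ r in 𝓝[>] (0 : ℝ), b.addHaar.real (Metric.closedBall x r) ≠ 0 := by
    filter_upwards [self_mem_nhdsWithin] with r hr
    exact (ENNReal.toReal_pos (Metric.measure_closedBall_pos _ x hr).ne'
      (isCompact_closedBall x r).measure_ne_top).ne'
  have hsm : Tendsto (fun r : ℝ => Metric.closedBall x r) (𝓝[>] 0) (𝓝 x).smallSets := by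
    rw [tendsto_smallSets_iff]
    intro s hs
    obtain ⟨ε, hε, h⟩ := Metric.nhds_basis_closedBall.mem_iff.1 hs
    filter_upwards [Ioo_mem_nhdsGT hε] with r hr
    exact (Metric.closedBall_subset_closedBall hr.2.le).trans h
  have h := (continuousAt_boxDensity (v := v) (e := e) hx).integral_sub_linear_isLittleO_ae
    (μ := b.addHaar) measurable_boxDensity.stronglyMeasurable.stronglyMeasurableAtFilter hsm
  have h2 := h.tendsto_div_nhds_zero.add_const (boxDensity b v e x)
  rw [zero_add] at h2
  refine h2.congr' ?_
  filter_upwards [hpos] with r hr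
  have e1 : ((cube I).map fun t => ∑ i, t i • v i).real (Metric.closedBall x r) =
      ∫ y in Metric.closedBall x r, boxDensity b v e y ∂b.addHaar := by
    rw [map_cube_eq_withDensity he hv, Measure.real, withDensity_apply _ measurableSet_closedBall,
      integral_eq_lintegral_of_nonneg_ae (.of_forall fun _ => boxDensity_nonneg _)
        measurable_boxDensity.aestronglyMeasurable]
  rw [e1, smul_eq_mul, sub_div, mul_div_cancel_left₀ _ hr, sub_add_cancel]

end Density

/-! ### Poisson summation -/

section Poisson

variable {I S V : Type*} [Fintype I] [DecidableEq I] [Fintype S]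
  [NormedAddCommGroup V] [InnerProductSpace ℝ V] [FiniteDimensional ℝ V]

/-- The characters of `V` that are trivial on the lattice spanned by `b`. -/
def latticeChars (b : Module.Basis S ℝ V) : Submonoid (V → ℂ) where
  carrier := {f | ∃ ξ : V →L[ℝ] ℝ, (∀ s, ∃ n : ℤ, ξ (b s) = n) ∧ f = expChar ξ}
  one_mem' := ⟨0, fun _ => ⟨0, by simp⟩, by ext; simp [expChar]⟩
  mul_mem' := by
    rintro _ _ ⟨ξ, hξ, rfl⟩ ⟨η, hη, rfl⟩
    refine ⟨ξ + η, fun s => ?_, by ext; simp [expChar, mul_add, Complex.exp_add]⟩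
    obtain ⟨m, hm⟩ := hξ s
    obtain ⟨n, hn⟩ := hη s
    exact ⟨m + n, by simp [hm, hn]⟩

/-- The trigonometric polynomials of `V` modulo the lattice spanned by `b`. -/
def trigPoly (b : Module.Basis S ℝ V) : Subalgebra ℂ (V → ℂ) :=
  Algebra.adjoin ℂ (latticeChars b)

/-- The function `∏ cos²(π x_s)`; on the centered parallelepiped it has its maximum exactly at the
origin, so that its powers form a peak family of trigonometric polynomials. -/
def cosPeak (b : Module.Basis S ℝ V) (x : V) : ℝ := ∏ s, Real.cos (Real.pi * b.repr x s) ^ 2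

lemma continuous_cosPeak (b : Module.Basis S ℝ V) : Continuous (cosPeak b) := by
  have h (s : S) := continuous_repr b s
  unfold cosPeak
  fun_prop

lemma cosPeak_nonneg (b : Module.Basis S ℝ V) (x : V) : 0 ≤ cosPeak b x :=
  Finset.prod_nonneg fun _ _ => sq_nonneg _

lemma cosPeak_zero (b : Module.Basis S ℝ V) : cosPeak b 0 = 1 := by simp [cosPeak]

lemma cosPeak_lt_one (b : Module.Basis S ℝ V) {x : V} (hx : x ∈ centeredBox b) (h0 : x ≠ 0) :
    cosPeak b x < 1 := by
  classical
  obtain ⟨s, hs⟩ : ∃ s, b.repr x s ≠ 0 := by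
    by_contra! h
    exact h0 (b.repr.map_eq_zero_iff.1 (Finsupp.ext h))
  have hle (s : S) : Real.cos (Real.pi * b.repr x s) ^ 2 ≤ 1 := Real.cos_sq_le_one _
  have hlt : Real.cos (Real.pi * b.repr x s) ^ 2 < 1 := by
    have h1 := hx s
    have hsin : Real.sin (Real.pi * b.repr x s) ≠ 0 := by
      rw [Ne, Real.sin_eq_zero_iff_of_lt_of_lt]
      · exact mul_ne_zero Real.pi_ne_zero hs
      · nlinarith [Real.pi_pos, h1.1]
      · nlinarith [Real.pi_pos, h1.2]
    have := Real.sin_sq_add_cos_sq (Real.pi * b.repr x s)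
    have := sq_pos_of_ne_zero hsin
    linarith
  rw [cosPeak, ← Finset.mul_prod_erase _ _ (Finset.mem_univ s)]
  exact (mul_le_of_le_one_right (sq_nonneg _)
    (Finset.prod_le_one (fun _ _ => sq_nonneg _) fun _ _ => hle _)).trans_lt hlt

lemma cosPeak_add (b : Module.Basis S ℝ V) {ν : V}
    (hν : ν ∈ Submodule.span ℤ (Set.range b)) (x : V) : cosPeak b (ν + x) = cosPeak b x := by
  unfold cosPeak
  refine Finset.prod_congr rfl fun s _ => ?_
  obtain ⟨n, hn⟩ := (b.mem_span_iff_repr_mem ℤ ν).1 hν s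
  have : Real.pi * b.repr (ν + x) s = Real.pi * b.repr x s + n * Real.pi := by
    rw [map_add, Finsupp.add_apply, ← hn]; simp; ring
  rw [this, Real.cos_add_int_mul_pi, mul_pow, ← sq_abs ((-1 : ℝ) ^ n), abs_neg_one_zpow]
  simp

lemma cosPeak_mem_trigPoly (b : Module.Basis S ℝ V) (n : ℕ) :
    (fun x => ((cosPeak b x ^ n : ℝ) : ℂ)) ∈ trigPoly b := by
  classical
  let ξ (s : S) : V →L[ℝ] ℝ := LinearMap.toContinuousLinearMap (b.coord s)
  have hξ (s : S) (c : ℤ) : expChar ((c : ℝ) • ξ s) ∈ trigPoly b := by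
    refine Algebra.subset_adjoin ⟨_, fun s' => ⟨if s' = s then c else 0, ?_⟩, rfl⟩
    simp [ξ, Finsupp.single_apply]
  have h : (fun x => ((cosPeak b x ^ n : ℝ) : ℂ)) = (∏ s, (1 / 4 : ℂ) •
      (algebraMap ℂ (V → ℂ) 2 + expChar (((1 : ℤ) : ℝ) • ξ s) +
        expChar (((-1 : ℤ) : ℝ) • ξ s))) ^ n := by
    ext x
    simp only [Pi.pow_apply, Finset.prod_apply, cosPeak]
    rw [Complex.ofReal_pow, Complex.ofReal_prod]
    congr 1
    refine Finset.prod_congr rfl fun s _ => ?_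
    have e1 (c : ℝ) : (c • ξ s) x = c * b.repr x s := rfl
    have h1 : Complex.exp (Real.pi * b.repr x s * Complex.I) *
        Complex.exp (-(Real.pi * b.repr x s) * Complex.I) = 1 := by
      rw [← Complex.exp_add]; simp
    have h2 : expChar (((1 : ℤ) : ℝ) • ξ s) x =
        Complex.exp (Real.pi * b.repr x s * Complex.I) ^ 2 := by
      rw [expChar, e1, ← Complex.exp_nat_mul]
      congr 1
      push_cast
      ring
    have h3 : expChar (((-1 : ℤ) : ℝ) • ξ s) x =
        Complex.exp (-(Real.pi * b.repr x s) * Complex.I) ^ 2 := by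
      rw [expChar, e1, ← Complex.exp_nat_mul]
      congr 1
      push_cast
      ring
    rw [Complex.ofReal_pow, Complex.ofReal_cos, Complex.ofReal_mul,
      Pi.smul_apply, Pi.add_apply, Pi.add_apply, h2, h3, Complex.cos, Pi.algebraMap_apply,
      Algebra.algebraMap_self, RingHom.id_apply, smul_eq_mul]
    linear_combination (1 / 2 : ℂ) * h1
  rw [h]
  refine pow_mem (prod_mem fun s _ => Subalgebra.smul_mem _ (add_mem (add_mem
    (Subalgebra.algebraMap_mem _ _) (hξ s 1)) (hξ s (-1))) _) n

variable [MeasurableSpace V] [BorelSpace V] {b : Module.Basis S ℝ V} {v : I → V} {e : S → I}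

/-- The integral of a trigonometric polynomial against `q · B`, with `q` in the Dahmen–Micchelli
space, only sees its mean: every nontrivial character integrates to zero. -/
lemma boxAvg_trigPoly_mul
    (hint : ∀ i, v i ∈ Submodule.span ℤ (Set.range b)) {q : V → ℂ}
    (hq : IsDM v Finset.univ q) {f : V → ℂ} (hf : f ∈ trigPoly b) :
    Continuous f ∧ boxAvg v Finset.univ (f * q) 0 =
      (∫ x in centeredBox b, f x ∂b.addHaar) * boxAvg v Finset.univ q 0 := by
  classical
  have hqc := hq.smooth.continuous
  have hcb (f : V → ℂ) (hf : Continuous f) : IntegrableOn f (centeredBox b) b.addHaar :=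
    hf.continuousOn.integrableOn_compact (isCompact_centeredBox b)
  have hf' : f ∈ Submodule.span ℂ (latticeChars b : Set (V → ℂ)) := by
    have := Algebra.adjoin_eq_span ℂ (latticeChars b : Set (V → ℂ))
    rw [Submonoid.closure_eq] at this
    rw [← this]
    exact hf
  clear hf
  induction hf' using Submodule.span_induction with
  | mem f hf =>
    obtain ⟨ξ, hξ, rfl⟩ := hf
    have hξc := (contDiff_expChar ξ).continuous
    refine ⟨hξc, ?_⟩
    -- the box spline of the basis itself is Lebesgue measure on the parallelepiped
    have hbox : ∫ x in centeredBox b, expChar ξ x ∂b.addHaar =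
        boxAvg b Finset.univ (expChar ξ) 0 := by
      rw [← map_cube_basis b Function.injective_id, integral_map
        (Continuous.measurable (by fun_prop)).aemeasurable (by fun_prop)]
      simp [boxAvg]
    by_cases h0 : ξ = 0
    · subst h0
      have h1 : expChar (0 : V →L[ℝ] ℝ) = 1 := by ext; simp [expChar]
      rw [hbox, h1, one_mul]
      simp [boxAvg]
    · have hspan : Submodule.span ℝ (b '' (Finset.univ : Finset S)) = ⊤ := by simp [b.span_eq]
      have h1 := boxAvg_expChar_mul h0 Finset.univ (fun s _ => hξ s) (IsDM.const hspan 1)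
      have e1 : (expChar ξ * fun _ => (1 : ℂ)) = expChar ξ := mul_one _
      rw [e1] at h1
      rw [hbox, h1, zero_mul]
      refine boxAvg_expChar_mul h0 Finset.univ (fun i _ => ?_) hq
      have hi := hint i
      generalize v i = w at hi
      induction hi using Submodule.span_induction with
      | mem x hx => obtain ⟨s, rfl⟩ := hx; exact hξ s
      | zero => exact ⟨0, by simp⟩
      | add x y _ _ hx hy =>
        obtain ⟨m, hm⟩ := hx
        obtain ⟨n, hn⟩ := hy
        exact ⟨m + n, by simp [hm, hn]⟩
      | smul c x _ hx =>
        obtain ⟨m, hm⟩ := hx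
        exact ⟨c * m, by simp [hm]⟩
  | zero => exact ⟨continuous_const, by simp [boxAvg]⟩
  | add f g _ _ hf hg =>
    refine ⟨hf.1.add hg.1, ?_⟩
    rw [add_mul, boxAvg_add (hf.1.mul hqc) (hg.1.mul hqc), hf.2, hg.2, ← add_mul]
    congr 1
    exact (integral_add (hcb _ hf.1) (hcb _ hg.1)).symm
  | smul c f _ hf =>
    refine ⟨hf.1.const_smul c, ?_⟩
    rw [smul_mul_assoc, boxAvg_smul, hf.2, ← mul_assoc]
    congr 1
    exact (integral_const_mul _ _).symm

/-- The translates of the centered parallelepiped by the lattice tile `V`. -/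
lemma integral_eq_tsum_centeredBox {F : V → ℂ} (hF : Integrable F b.addHaar) :
    ∫ x, F x ∂b.addHaar = ∑' ν : Submodule.span ℤ (Set.range b),
      ∫ x in centeredBox b, F (ν + x) ∂b.addHaar := by
  let D : Set V := (fun x => x + ∑ s, (1 / 2 : ℝ) • b s) ⁻¹' ZSpan.fundamentalDomain b
  have hD : IsAddFundamentalDomain (Submodule.span ℤ (Set.range b)) D b.addHaar := by
    refine IsAddFundamentalDomain.mk' ?_ fun x => ?_
    · exact ((ZSpan.fundamentalDomain_measurableSet b).preimage (by fun_prop)).nullMeasurableSet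
    · have := ZSpan.exist_unique_vadd_mem_fundamentalDomain b (x + ∑ s, (1 / 2 : ℝ) • b s)
      simpa only [D, Set.mem_preimage, vadd_add_assoc] using this
  have hae : D =ᵐ[b.addHaar] centeredBox b := by
    have hrepr (x : V) (s : S) : b.repr (x + ∑ s, (1 / 2 : ℝ) • b s) s = b.repr x s + 1 / 2 := by
      classical
      simp [Finsupp.single_apply]
    filter_upwards [ae_abs_repr_ne b] with x hx
    refine propext ⟨fun h s => ?_, fun h s => ?_⟩
    · have := h s
      rw [hrepr] at this
      constructor <;> linarith [this.1, this.2]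
    · have h1 := h s
      have h2 : b.repr x s ≠ 1 / 2 := fun h2 => hx s (by rw [h2]; norm_num)
      have h3 := lt_of_le_of_ne h1.2 h2
      rw [hrepr]
      constructor <;> linarith [h1.1]
  have : VAddInvariantMeasure (Submodule.span ℤ (Set.range b)) V b.addHaar :=
    inferInstanceAs <| VAddInvariantMeasure (Submodule.span ℤ (Set.range b)).toAddSubgroup V _
  rw [hD.integral_eq_tsum'' F hF]
  refine tsum_congr fun ν => ?_
  rw [setIntegral_congr_set hae]
  rfl

lemma finite_norm_le (b : Module.Basis S ℝ V) (R : ℝ) :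
    {ν : Submodule.span ℤ (Set.range b) | ‖(ν : V)‖ ≤ R}.Finite := by
  have h := ZSpan.setFinite_inter b (Metric.isBounded_closedBall (x := (0 : V)) (r := R))
  refine (h.preimage Subtype.val_injective.injOn).subset fun ν hν => ?_
  exact ⟨by simpa using hν, ν.2⟩

lemma abs_intCast_ne_half (n : ℤ) : |(n : ℝ)| ≠ 1 / 2 := by
  intro h
  have h2 : (2 * |n| : ℤ) = 1 := by
    have h3 : (2 * |(n : ℝ)|) = 1 := by rw [h]; norm_num
    exact_mod_cast h3
  omega

/-- Poisson summation for the box spline: for `q` in the Dahmen–Micchelli space, summing `q`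
against the values of the density at lattice points gives the same result as integrating `q` against
the box spline. -/
theorem finsum_boxDensity_mul (he : Function.Injective e) (hv : ∀ s, v (e s) = b s)
    (hint : ∀ i, v i ∈ Submodule.span ℤ (Set.range b)) {q : V → ℂ} (hq : IsDM v Finset.univ q) :
    ∑ᶠ ν : Submodule.span ℤ (Set.range b), (boxDensity b v e ν : ℂ) * q ν =
      boxAvg v Finset.univ q 0 := by
  have hqc := hq.smooth.continuous
  obtain ⟨R, hR⟩ := exists_norm_le_of_boxDensity_ne_zero b v e
  obtain ⟨R', hR'⟩ := (isCompact_centeredBox b).isBounded.exists_norm_le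
  have hβm : Measurable (boxDensity b v e) := measurable_boxDensity
  have h0mem : (0 : V) ∈ centeredBox b := fun s => by simp
  have hR'0 : 0 ≤ R' := (norm_nonneg _).trans (hR' 0 h0mem)
  set N := (finite_norm_le b (R + R')).toFinset with hN
  have hNmem (ν : Submodule.span ℤ (Set.range b)) (hν : ν ∉ N) (x : V) (hx : x ∈ centeredBox b) :
      boxDensity b v e (ν + x) = 0 := by
    by_contra h
    refine hν ?_
    rw [hN, Set.Finite.mem_toFinset]
    have h1 := hR _ h
    have h2 := hR' x hx
    calc ‖(ν : V)‖ = ‖(ν + x) - x‖ := by rw [add_sub_cancel_right]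
      _ ≤ R + R' := (norm_sub_le _ _).trans (add_le_add h1 h2)
  let G : V → ℂ := fun x => ∑ ν ∈ N, (boxDensity b v e (ν + x) : ℂ) * q (ν + x)
  have hG0 : G 0 = ∑ᶠ ν : Submodule.span ℤ (Set.range b), (boxDensity b v e ν : ℂ) * q ν := by
    rw [finsum_eq_sum_of_support_subset (s := N)]
    · simp [G]
    · intro ν hν
      by_contra h
      refine hν ?_
      have := hNmem ν h 0 h0mem
      rw [add_zero] at this
      simp [this]
  -- integrability on compact sets of continuous functions times the bounded density
  have hint1 (f : V → ℂ) (hf : Continuous f) (w : V) {K : Set V} (hK : IsCompact K) :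
      IntegrableOn (fun x => (boxDensity b v e (w + x) : ℂ) * f x) K b.addHaar := by
    refine (hf.continuousOn.integrableOn_compact hK).bdd_mul (c := 1)
      (Measurable.aestronglyMeasurable (by fun_prop)) (.of_forall fun x => ?_)
    rw [Complex.norm_real, Real.norm_of_nonneg (boxDensity_nonneg _)]
    exact boxDensity_le_one _
  have hint2 (f : V → ℂ) (hf : Continuous f) :
      Integrable (fun x => (boxDensity b v e x : ℂ) * f x) b.addHaar := by
    have h := hint1 f hf 0 (isCompact_closedBall (0 : V) R)
    simp only [zero_add] at h
    refine (integrableOn_iff_integrable_of_support_subset fun x hx => ?_).1 h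
    rw [mem_closedBall_zero_iff]
    exact hR x fun h => hx (by simp [h])
  have hconst (n : ℕ) : ∫ x in centeredBox b, (cosPeak b x) ^ n • G x ∂b.addHaar =
      ((∫ x in centeredBox b, cosPeak b x ^ n ∂b.addHaar : ℝ) : ℂ) * boxAvg v Finset.univ q 0 := by
    have hc := continuous_cosPeak b
    have h1 := (boxAvg_trigPoly_mul hint hq (cosPeak_mem_trigPoly b n)).2
    rw [integral_complex_ofReal] at h1
    rw [← h1, boxAvg_univ_eq_integral he hv (by fun_prop)]
    simp only [zero_add, Pi.mul_apply]
    rw [integral_eq_tsum_centeredBox (hint2 _ (by fun_prop)), tsum_eq_sum (s := N),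
      ← integral_finsetSum]
    · refine integral_congr_ae (.of_forall fun x => ?_)
      simp only [G, Finset.smul_sum, cosPeak_add b (Subtype.prop _), Complex.real_smul]
      exact Finset.sum_congr rfl fun ν _ => by ring
    · intro ν _
      have := hint1 (fun x => ((cosPeak b (ν + x) ^ n : ℝ) : ℂ) * q (ν + x)) (by fun_prop) ν
        (isCompact_centeredBox b)
      exact this
    · intro ν hν
      refine setIntegral_eq_zero_of_forall_eq_zero fun x hx => ?_
      rw [hNmem ν hν x hx]; simp
  have hpeak : Tendsto (fun n : ℕ => (∫ x in centeredBox b, cosPeak b x ^ n ∂b.addHaar)⁻¹ •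
      ∫ x in centeredBox b, cosPeak b x ^ n • G x ∂b.addHaar) atTop (𝓝 (G 0)) := by
    have hint0 : (0 : V) ∈ interior (centeredBox b) := by
      by_contra h
      exact notMem_frontier_centeredBox b (x := 0) (fun s => by simp)
        ⟨subset_closure h0mem, h⟩
    refine tendsto_setIntegral_pow_smul_of_unique_maximum_of_isCompact_of_integrableOn
      (isCompact_centeredBox b) (continuous_cosPeak b).continuousOn ?_ (fun x _ => cosPeak_nonneg b x)
      ?_ (subset_closure hint0) ?_ ?_
    · intro y hy hy0
      rw [cosPeak_zero]
      exact cosPeak_lt_one b hy hy0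
    · rw [cosPeak_zero]; exact one_pos
    · exact integrable_finsetSum _ fun ν _ =>
        hint1 (fun x => q (ν + x)) (by fun_prop) ν (isCompact_centeredBox b)
    · refine ContinuousAt.continuousWithinAt ?_
      refine tendsto_finsetSum _ fun ν _ => ?_
      have hβ : ContinuousAt (boxDensity b v e) ν := by
        refine continuousAt_boxDensity fun s => ?_
        obtain ⟨n, hn⟩ := (b.mem_span_iff_repr_mem ℤ (ν : V)).1 ν.2 s
        rw [← hn]
        exact abs_intCast_ne_half n
      have hadd : ContinuousAt (fun x : V => (ν : V) + x) 0 := by fun_prop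
      have hβ' : ContinuousAt (fun x : V => boxDensity b v e (ν + x)) 0 :=
        ContinuousAt.comp (g := boxDensity b v e) (f := fun x : V => (ν : V) + x) (x := 0)
          (by simpa using hβ) hadd
      exact ((Complex.continuous_ofReal.continuousAt.comp hβ').mul
        (hqc.continuousAt.comp hadd)).tendsto
  rw [← hG0]
  refine tendsto_nhds_unique hpeak (tendsto_const_nhds.congr fun n => ?_)
  have hpos : 0 < ∫ x in centeredBox b, cosPeak b x ^ n ∂b.addHaar := by
    have hc := continuous_cosPeak b
    rw [setIntegral_pos_iff_support_of_nonneg_ae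
      (.of_forall fun x => pow_nonneg (cosPeak_nonneg b x) n)
      ((hc.pow n).continuousOn.integrableOn_compact (isCompact_centeredBox b))]
    have hU : IsOpen ({x | cosPeak b x ≠ 0} ∩ interior (centeredBox b)) :=
      (isOpen_ne_fun hc continuous_const).inter isOpen_interior
    refine (hU.measure_pos b.addHaar ⟨0, by simp [cosPeak_zero], ?_⟩).trans_le
      (measure_mono fun x hx => ⟨pow_ne_zero n hx.1, interior_subset hx.2⟩)
    by_contra h
    exact notMem_frontier_centeredBox b (x := 0) (fun s => by simp) ⟨subset_closure h0mem, h⟩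
  rw [hconst, Complex.real_smul, ← mul_assoc, ← Complex.ofReal_mul, inv_mul_cancel₀ hpos.ne',
    Complex.ofReal_one, one_mul]

/-- A polynomial (or just analytic) function that is almost everywhere a locally finite combination
of lattice translates of the box spline lies in the Dahmen–Micchelli space. -/
theorem isDM_of_ae_eq_finsum (he : Function.Injective e) (hv : ∀ s, v (e s) = b s) {p : V → ℂ}
    (hp : ContDiff ℝ ω p) (m : Submodule.span ℤ (Set.range b) → ℂ)
    (h : p =ᵐ[b.addHaar] fun x => ∑ᶠ ν, m ν * (boxDensity b v e (x - ν) : ℂ)) :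
    IsDM v Finset.univ p := by
  obtain ⟨R, hR⟩ := exists_norm_le_of_boxDensity_ne_zero b v e
  refine isDM_of_mem_span b.addHaar (W := Metric.ball 0 1) Metric.isOpen_ball
    ⟨0, by simp⟩ Finset.univ hp ?_
  set N := (finite_norm_le b (1 + R)).toFinset with hN
  have e1 : (fun φ : TestFun (Metric.ball (0 : V) 1) => ∫ x, φ.1 x * p x ∂b.addHaar) =
      ∑ ν ∈ N, m ν • fun φ : TestFun (Metric.ball (0 : V) 1) => boxAvg v Finset.univ φ.1 ν := by
    ext φ
    have hφc := φ.2.1.continuous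
    simp only [Finset.sum_apply, Pi.smul_apply, smul_eq_mul]
    have h2 (ν : V) : boxAvg v Finset.univ φ.1 ν =
        ∫ x, (boxDensity b v e (x - ν) : ℂ) * φ.1 x ∂b.addHaar := by
      rw [boxAvg_univ_eq_integral he hv hφc,
        ← integral_add_right_eq_self (fun x => (boxDensity b v e (x - ν) : ℂ) * φ.1 x) ν]
      simp [add_comm]
    have h3 (ν : V) : Integrable (fun x => (boxDensity b v e (x - ν) : ℂ) * φ.1 x) b.addHaar := by
      have hβm : Measurable (boxDensity b v e) := measurable_boxDensity
      refine (hφc.integrable_of_hasCompactSupport φ.2.2.1).bdd_mul (c := 1)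
        (Measurable.aestronglyMeasurable (by fun_prop)) (.of_forall fun x => ?_)
      rw [Complex.norm_real, Real.norm_of_nonneg (boxDensity_nonneg _)]
      exact boxDensity_le_one _
    simp only [h2, ← integral_const_mul]
    rw [← integral_finsetSum N fun ν _ => (h3 ν).const_mul (m ν)]
    refine integral_congr_ae ?_
    filter_upwards [h] with x hx
    by_cases hxW : x ∈ Metric.ball (0 : V) 1
    · rw [hx, finsum_eq_sum_of_support_subset (s := N), Finset.mul_sum]
      · exact Finset.sum_congr rfl fun ν _ => by ring
      · intro ν hν
        rw [hN, Set.Finite.coe_toFinset]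
        have h4 : boxDensity b v e (x - ν) ≠ 0 := fun h0 => hν (by simp [h0])
        have h5 := hR _ h4
        rw [mem_ball_zero_iff] at hxW
        calc ‖(ν : V)‖ = ‖x - (x - ν)‖ := by rw [sub_sub_cancel]
          _ ≤ 1 + R := (norm_sub_le _ _).trans (add_le_add hxW.le h5)
    · have : φ.1 x = 0 := image_eq_zero_of_notMem_tsupport fun h => hxW (φ.2.2.2 h)
      simp [this]
  rw [e1]
  exact Submodule.sum_mem _ fun ν _ => Submodule.smul_mem _ _ (Submodule.subset_span ⟨_, rfl⟩)

end Poisson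

/-! ### The box spline of the positive roots of a root system -/

section RootSystem

variable {ι V N : Type*} [Finite ι] [NormedAddCommGroup V] [InnerProductSpace ℝ V]
  [AddCommGroup N] [Module ℝ N] {P : RootPairing ι ℝ V N} [P.IsRootSystem] (Δ : P.Base)

/-- The simple roots, as positive roots. -/
def simpleRoot (s : Δ.support) : PosRoot Δ :=
  ⟨s, AddSubmonoid.subset_closure ⟨s, s.2, rfl⟩⟩

omit [Finite ι] [P.IsRootSystem] in
lemma simpleRoot_injective : Function.Injective (simpleRoot Δ) := fun s t h => by
  apply Subtype.ext
  exact congrArg (fun i : PosRoot Δ => (i : ι)) h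

lemma posRoots_simpleRoot (s : Δ.support) :
    posRoots Δ (simpleRoot Δ s) = Δ.toWeightBasis s := (Δ.toWeightBasis_apply s).symm

lemma rootLattice_eq : rootLattice P = Submodule.span ℤ (Set.range Δ.toWeightBasis) := by
  rw [rootLattice, ← Δ.span_int_root_support]
  congr 1
  ext x
  simp

lemma posRoots_mem (α : PosRoot Δ) :
    posRoots Δ α ∈ Submodule.span ℤ (Set.range Δ.toWeightBasis) := by
  rw [← rootLattice_eq]
  exact Submodule.subset_span ⟨α, rfl⟩

lemma span_posRoots [DecidableEq (PosRoot Δ)] :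
    Submodule.span ℝ (posRoots Δ '' (Finset.univ : Finset (PosRoot Δ))) = ⊤ := by
  rw [eq_top_iff, ← Δ.toWeightBasis.span_eq]
  refine Submodule.span_mono ?_
  rintro _ ⟨s, rfl⟩
  exact ⟨simpleRoot Δ s, by simp, posRoots_simpleRoot Δ s⟩

variable [MeasurableSpace V] [BorelSpace V]

instance : (latticeVolume Δ).IsAddHaarMeasure :=
  inferInstanceAs Δ.toWeightBasis.addHaar.IsAddHaarMeasure

open Classical in
/-- The explicit density of the box spline of the positive roots, built on the simple roots. -/
def rootDensity : V → ℝ := boxDensity Δ.toWeightBasis (posRoots Δ) (simpleRoot Δ)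

lemma density_eq_rootDensity {x : V} (hx : ∀ s, |Δ.toWeightBasis.repr x s| ≠ 1 / 2) :
    density Δ x = rootDensity Δ x := by
  have := Δ.toWeightBasis.finiteDimensional_of_finite
  classical
  refine Tendsto.limUnder_eq ?_
  exact tendsto_mean_boxDensity (simpleRoot_injective Δ) (posRoots_simpleRoot Δ) hx

lemma density_eq_rootDensity_of_mem (τ : rootLattice P) :
    density Δ (τ : V) = rootDensity Δ τ := by
  refine density_eq_rootDensity Δ fun s => ?_
  have hτ : (τ : V) ∈ Submodule.span ℤ (Set.range Δ.toWeightBasis) := rootLattice_eq Δ ▸ τ.2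
  obtain ⟨n, hn⟩ := (Δ.toWeightBasis.mem_span_iff_repr_mem ℤ (τ : V)).1 hτ s
  rw [← hn]
  exact abs_intCast_ne_half n

open Classical in
lemma isDM_of_mem_dmSpace {p : V → ℂ} (hp : p ∈ dmSpace Δ) :
    IsDM (posRoots Δ) Finset.univ p := by
  have := Δ.toWeightBasis.finiteDimensional_of_finite
  obtain ⟨hpoly, m, hm⟩ := hp
  have hL := rootLattice_eq Δ
  have hcount : Countable (rootLattice P) := by
    rw [hL]; infer_instance
  -- almost everywhere, all translates of the two versions of the density agree
  have hae : ∀ᵐ x ∂latticeVolume Δ, ∀ ν : rootLattice P,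
      density Δ (x - ν) = rootDensity Δ (x - ν) := by
    rw [ae_all_iff]
    intro ν
    have h := (measurePreserving_sub_right (latticeVolume Δ : Measure V)
      (ν : V)).quasiMeasurePreserving.ae (ae_abs_repr_ne Δ.toWeightBasis)
    filter_upwards [h] with x hx
    exact density_eq_rootDensity Δ hx
  have hm' : p =ᵐ[latticeVolume Δ] fun x =>
      ∑ᶠ ν : rootLattice P, m ν * (rootDensity Δ (x - ν) : ℂ) := by
    filter_upwards [hm, hae] with x hx h
    rw [hx, boxConv]
    exact finsum_congr fun ν => by rw [h]
  clear hm hae hcount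
  generalize rootLattice P = L at hL m hm'
  subst hL
  exact isDM_of_ae_eq_finsum (simpleRoot_injective Δ) (posRoots_simpleRoot Δ)
    (contDiff_of_mem_polyFun hpoly) m hm'

open Classical in
lemma finsum_density_mul {q : V → ℂ} (hq : IsDM (posRoots Δ) Finset.univ q) :
    ∑ᶠ τ : rootLattice P, (density Δ (τ : V) : ℂ) * q τ =
      boxAvg (posRoots Δ) Finset.univ q 0 := by
  have := Δ.toWeightBasis.finiteDimensional_of_finite
  simp only [density_eq_rootDensity_of_mem]
  rw [rootLattice_eq Δ]
  exact finsum_boxDensity_mul (simpleRoot_injective Δ) (posRoots_simpleRoot Δ) (posRoots_mem Δ) hq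

lemma exists_finset_density_eq_zero :
    ∃ F : Finset (rootLattice P), ∀ τ ∉ F, density Δ (τ : V) = 0 := by
  have := Δ.toWeightBasis.finiteDimensional_of_finite
  classical
  obtain ⟨R, hR⟩ := exists_norm_le_of_boxDensity_ne_zero Δ.toWeightBasis (posRoots Δ) (simpleRoot Δ)
  have hfin : {τ : rootLattice P | ‖(τ : V)‖ ≤ R}.Finite := by
    rw [rootLattice_eq Δ]
    exact finite_norm_le _ R
  refine ⟨hfin.toFinset, fun τ hτ => (density_eq_rootDensity_of_mem Δ τ).trans ?_⟩
  by_contra h0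
  exact hτ (hfin.mem_toFinset.2 (hR _ h0))

/-- The box spline Laplacian as a finite combination of second differences, uniformly in the
function and the point. -/
lemma exists_laplacian_eq_sum : ∃ F : Finset (rootLattice P), ∀ f : V → ℂ, laplacian Δ f =
    ∑ τ ∈ F, (density Δ (τ : V) : ℂ) • bwd (τ : V) (fwd (τ : V) f) := by
  obtain ⟨F, hF⟩ := exists_finset_density_eq_zero Δ
  refine ⟨F, fun f => ?_⟩
  ext x
  rw [laplacian, finsum_eq_sum_of_support_subset (s := F)]
  · simp
  · intro τ hτ
    by_contra h
    exact hτ (by simp [hF τ h])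

lemma contDiff_laplacian {f : V → ℂ} (hf : ContDiff ℝ ω f) : ContDiff ℝ ω (laplacian Δ f) := by
  obtain ⟨F, hF⟩ := exists_laplacian_eq_sum Δ
  have : laplacian Δ f = fun x => ∑ τ ∈ F, ((density Δ (τ : V) : ℂ) •
      bwd (τ : V) (fwd (τ : V) f)) x := by rw [hF]; ext; simp
  rw [this]
  exact ContDiff.sum fun τ _ => contDiff_const.smul (contDiff_bwd (contDiff_fwd hf _) _)

lemma DegLT.laplacian {k : ℕ} {f : V → ℂ} (hf : ContDiff ℝ ω f) (h : DegLT k f) :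
    DegLT (k - 2) (laplacian Δ f) := by
  obtain ⟨F, hF⟩ := exists_laplacian_eq_sum Δ
  rw [hF]
  refine DegLT.sum _ (fun τ _ => contDiff_const.smul (contDiff_bwd (contDiff_fwd hf _) _))
    fun τ _ => DegLT.smul (contDiff_bwd (contDiff_fwd hf _) _) ?_ _
  exact (h.fwd hf τ).bwd (contDiff_fwd hf _) τ

open Classical in
/-- On the Dahmen–Micchelli space, `-𝒟/2` is the identity minus averaging against the box spline. -/
lemma neg_half_laplacian_eq {q : V → ℂ} (hq : IsDM (posRoots Δ) Finset.univ q) :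
    (-(1 / 2) : ℂ) • laplacian Δ q = q - boxAvg (posRoots Δ) Finset.univ q := by
  ext x
  have hc := hq.smooth.continuous
  have h1 := hq.comp_add x
  have h2 := h1.comp_neg
  have h3 : IsDM (posRoots Δ) Finset.univ (fun _ : V => -2 * q x) :=
    IsDM.const (span_posRoots Δ) _
  have h := finsum_density_mul Δ ((h1.add h2).add h3)
  rw [boxAvg_add (by fun_prop) (by fun_prop), boxAvg_add (by fun_prop) (by fun_prop),
    boxAvg_comp_neg (f := fun y => q (y + x)), neg_zero, boxAvg_comp_add, zero_add] at h
  have h4 : boxAvg (posRoots Δ) Finset.univ (fun _ : V => -2 * q x) 0 = -2 * q x := by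
    simp [boxAvg]
  have h5 : laplacian Δ q x = boxAvg (posRoots Δ) Finset.univ q x +
      boxAvg (posRoots Δ) Finset.univ q x + -2 * q x := by
    rw [← h4, ← h, laplacian]
    refine finsum_congr fun τ => ?_
    congr 1
    simp only [bwd, fwd, Pi.add_apply, sub_add_cancel]
    rw [add_comm (τ : V) x, show -(τ : V) + x = x - τ by abel]
    ring
  simp only [Pi.smul_apply, Pi.sub_apply, smul_eq_mul, h5]
  ring

open Classical in
lemma IsDM.neg_half_laplacian {q : V → ℂ} (hq : IsDM (posRoots Δ) Finset.univ q) :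
    IsDM (posRoots Δ) Finset.univ ((-(1 / 2) : ℂ) • BoxSpline.laplacian Δ q) := by
  obtain ⟨F, hF⟩ := exists_laplacian_eq_sum Δ
  have hfwd {f : V → ℂ} (hf : IsDM (posRoots Δ) Finset.univ f) (τ : V) :
      IsDM (posRoots Δ) Finset.univ (fwd τ f) := by
    rw [fwd_eq]; exact (hf.comp_add τ).add (hf.smul _)
  rw [hF]
  refine (IsDM.sum _ fun τ _ => IsDM.smul ?_ _).smul _
  rw [bwd_eq]
  exact (hfwd (hfwd hq τ) τ).comp_add _

open Classical in
lemma IsDM.iterate_neg_half_laplacian {q : V → ℂ} (hq : IsDM (posRoots Δ) Finset.univ q) (k : ℕ) :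
    IsDM (posRoots Δ) Finset.univ
      ((fun f : V → ℂ => (-(1 / 2) : ℂ) • BoxSpline.laplacian Δ f)^[k] q) := by
  induction k with
  | zero => exact hq
  | succ k ih => rw [Function.iterate_succ_apply']; exact ih.neg_half_laplacian Δ

lemma DegLT.iterate_neg_half_laplacian {l : ℕ} {f : V → ℂ} (hf : ContDiff ℝ ω f)
    (h : DegLT l f) (k : ℕ) :
    DegLT (l - 2 * k) ((fun f : V → ℂ => (-(1 / 2) : ℂ) • BoxSpline.laplacian Δ f)^[k] f) := by
  induction k generalizing l f with
  | zero => exact h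
  | succ k ih =>
    have h1 := contDiff_laplacian Δ hf
    rw [Function.iterate_succ_apply, show l - 2 * (k + 1) = l - 2 - 2 * k by omega]
    exact ih (contDiff_const.smul h1) ((h.laplacian Δ hf).smul h1 _)

open Classical in
/-- The partial sums of the Neumann series of `1 - (1 - E)`, where `E` is averaging against the box
spline. -/
lemma boxAvg_neumann_sum {q : V → ℂ} (hq : IsDM (posRoots Δ) Finset.univ q) (K : ℕ) :
    boxAvg (posRoots Δ) Finset.univ (∑ k ∈ Finset.range K,
      (fun f : V → ℂ => (-(1 / 2) : ℂ) • laplacian Δ f)^[k] q) =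
    q - (fun f : V → ℂ => (-(1 / 2) : ℂ) • laplacian Δ f)^[K] q := by
  induction K with
  | zero => ext x; simp [boxAvg]
  | succ K ih =>
    have hK := hq.iterate_neg_half_laplacian Δ K
    have hS : IsDM (posRoots Δ) Finset.univ (∑ k ∈ Finset.range K,
        (fun f : V → ℂ => (-(1 / 2) : ℂ) • laplacian Δ f)^[k] q) :=
      IsDM.sum _ fun k _ => hq.iterate_neg_half_laplacian Δ k
    ext x
    have h1 := congrFun ih x
    have h2 := congrFun (neg_half_laplacian_eq Δ hK) x
    rw [Finset.sum_range_succ, boxAvg_add hS.smooth.continuous hK.smooth.continuous, h1,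
      Function.iterate_succ_apply']
    rw [Pi.sub_apply] at h2
    rw [Pi.sub_apply, Pi.sub_apply, h2]
    ring

end RootSystem

end BoxSpline

end

theorem proposition5p15 {ι V N : Type*} [Finite ι]
    [NormedAddCommGroup V] [InnerProductSpace ℝ V] [MeasurableSpace V] [BorelSpace V]
    [AddCommGroup N] [Module ℝ N]
    (P : RootPairing ι ℝ V N) [P.IsRootSystem] [P.IsCrystallographic] [P.IsReduced]
    (Δ : P.Base) (p : V → ℂ) (hp : p ∈ BoxSpline.dmSpace Δ) :
    {n : BoxSpline.PosRoot Δ → ℕ | BoxSpline.ahatTerm Δ n p ≠ 0}.Finite ∧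
      BoxSpline.ahat Δ p =
        ∑ k ∈ Finset.range (BoxSpline.degD Δ / 2 + 1),
          (fun f : V → ℂ => (-(1 / 2) : ℂ) • BoxSpline.laplacian Δ f)^[k] p := by
  classical
  have := Δ.toWeightBasis.finiteDimensional_of_finite
  have hDM := BoxSpline.isDM_of_mem_dmSpace Δ hp
  have hdeg {q : V → ℂ} (hq : BoxSpline.IsDM (BoxSpline.posRoots Δ) Finset.univ q) :
      BoxSpline.DegLT (BoxSpline.degD Δ + 1) q := by
    refine hq.degLT.mono ?_
    rw [BoxSpline.degD, Finset.card_univ]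
    omega
  refine ⟨BoxSpline.finite_ahatTerm_ne_zero Δ ⟨p, hDM.smooth⟩ (hdeg hDM), ?_⟩
  set S := ∑ k ∈ Finset.range (BoxSpline.degD Δ / 2 + 1),
    (fun f : V → ℂ => (-(1 / 2) : ℂ) • BoxSpline.laplacian Δ f)^[k] p with hS
  have hSDM : BoxSpline.IsDM (BoxSpline.posRoots Δ) Finset.univ S :=
    BoxSpline.IsDM.sum _ fun k _ => hDM.iterate_neg_half_laplacian Δ k
  have hzero : (fun f : V → ℂ => (-(1 / 2) : ℂ) • BoxSpline.laplacian Δ f)^[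
      BoxSpline.degD Δ / 2 + 1] p = 0 := by
    have h := (hdeg hDM).iterate_neg_half_laplacian Δ hDM.smooth (BoxSpline.degD Δ / 2 + 1)
    rwa [show BoxSpline.degD Δ + 1 - 2 * (BoxSpline.degD Δ / 2 + 1) = 0 by omega] at h
  have hE := BoxSpline.boxAvg_neumann_sum Δ hDM (BoxSpline.degD Δ / 2 + 1)
  rw [hzero, sub_zero, ← hS] at hE
  rw [← BoxSpline.ahat_boxAvg Δ hSDM.smooth (hdeg hSDM), hE]
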